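/- Let $G$ be a simply connected nilpotent Lie group of real dimension $2n$, let $\Gamma \subset G$ be a discrete subgroup such that $M = \Gamma\backslash G$ is compact, let $J$ be a left-invariant complex structure on $M$ and let $g$ be a left-invariant $J$-Hermitian metric on $M$, with fundamental form $\omega(X,Y) = g(JX,Y)$. (A tensor field on $M$ is called left-invariant if it is induced, through the projection $G \to \Gamma\backslash G$, by a left-invariant tensor field on $G$.) For $1 \le k \le n-1$ the metric is called $k$-Gauduchon if $$dd^c\omega^{k} \wedge \omega^{n-k-1} = 0, \qquad d^c = -J^{-1} d J,$$ where $J$ acts on $p$-forms by $(J\eta)(X_1,\dots,X_p) = (-1)^p\,\eta(JX_1,\dots,JX_p)$. Then for every integer $k$ with $1 \le k < n-1$, the metric is $k$-Gauduchon if and only if it is $1$-Gauduchon. -/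

import Mathlib

open scoped Manifold ContDiff

namespace Nilmanifold

noncomputable section

/-! ### Exterior algebra of one vector space -/

section Wedge

variable {V : Type*} [AddCommGroup V] [Module ℝ V] [TopologicalSpace V]

theorem continuous_domCoprod_summand {p q : ℕ} (a : V [⋀^Fin p]→L[ℝ] ℝ) (b : V [⋀^Fin q]→L[ℝ] ℝ)
    (σ : Equiv.Perm.ModSumCongr (Fin p) (Fin q)) :
    Continuous fun v : Fin p ⊕ Fin q → V =>
      LinearMap.mul' ℝ ℝ
        (AlternatingMap.domCoprod.summand a.toAlternatingMap b.toAlternatingMap σ v) := by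
  induction σ using Quotient.inductionOn' with
  | h σ =>
    have h : (fun v : Fin p ⊕ Fin q → V =>
        LinearMap.mul' ℝ ℝ (AlternatingMap.domCoprod.summand a.toAlternatingMap b.toAlternatingMap
          (Quotient.mk'' σ) v)) =
        fun v => (((Equiv.Perm.sign σ : ℤˣ) : ℤ) : ℝ) *
          (a (fun i => v (σ (Sum.inl i))) * b (fun j => v (σ (Sum.inr j)))) := by
      funext v
      rw [AlternatingMap.domCoprod.summand_mk'']
      rcases Int.units_eq_one_or (Equiv.Perm.sign σ) with hs | hs <;> simp [hs]
    rw [h]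
    have ha : Continuous fun v : Fin p ⊕ Fin q → V => a (fun i => v (σ (Sum.inl i))) :=
      a.cont.comp (continuous_pi fun i => continuous_apply _)
    have hb : Continuous fun v : Fin p ⊕ Fin q → V => b (fun i => v (σ (Sum.inr i))) :=
      b.cont.comp (continuous_pi fun i => continuous_apply _)
    exact continuous_const.mul (ha.mul hb)

/-- The exterior product of two real-valued alternating forms,
`(a ∧ b)(v₁, …, v_{p+q}) = ∑ sign σ · a(v_{σ(1)}, …, v_{σ(p)}) · b(v_{σ(p+1)}, …, v_{σ(p+q)})`,
the sum being over `(p, q)`-shuffles. -/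
def wedge {p q : ℕ} (a : V [⋀^Fin p]→L[ℝ] ℝ) (b : V [⋀^Fin q]→L[ℝ] ℝ) :
    V [⋀^Fin (p + q)]→L[ℝ] ℝ :=
  { (((LinearMap.mul' ℝ ℝ).compAlternatingMap
      (a.toAlternatingMap.domCoprod b.toAlternatingMap)).domDomCongr finSumFinEquiv) with
    cont := by
      have h : Continuous fun w : Fin p ⊕ Fin q → V =>
          LinearMap.mul' ℝ ℝ (a.toAlternatingMap.domCoprod b.toAlternatingMap w) := by
        simp only [AlternatingMap.domCoprod_apply, sum_apply, map_sum]
        exact continuous_finsetSum _ fun σ _ => continuous_domCoprod_summand a b σ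
      exact h.comp (continuous_pi fun i => continuous_apply (finSumFinEquiv i)) }

/-- The exterior power `w^k = w ∧ ⋯ ∧ w` of a `2`-form. -/
def wedgePow (w : V [⋀^Fin 2]→L[ℝ] ℝ) : (k : ℕ) → V [⋀^Fin (2 * k)]→L[ℝ] ℝ
  | 0 => ContinuousAlternatingMap.constOfIsEmpty ℝ V (Fin 0) 1
  | k + 1 => wedge (wedgePow w k) w

end Wedge

/-! ### Differential forms on a manifold modelled on `E` -/

section Forms

variable (E : Type*) [NormedAddCommGroup E] [NormedSpace ℝ E]
  (M : Type*) [TopologicalSpace M] [ChartedSpace E M]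

/-- Real differential `p`-forms on `M` (smoothness is not bundled). -/
abbrev Form (p : ℕ) : Type _ := (x : M) → (TangentSpace 𝓘(ℝ, E) x) [⋀^Fin p]→L[ℝ] ℝ

variable {E M}

/-- The expression of the form `η` in the chart at `x₀`: its pullback by the inverse chart. -/
def Form.inChart {p : ℕ} (η : Form E M p) (x₀ : M) (y : E) : E [⋀^Fin p]→L[ℝ] ℝ :=
  (η ((chartAt E x₀).symm y)).compContinuousLinearMap
    (mfderiv 𝓘(ℝ, E) 𝓘(ℝ, E) (chartAt E x₀).symm y)

/-- The exterior derivative of a form on `M`: at `x₀`, differentiate the expression of the form in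
the chart at `x₀` and pull the result back by this chart. -/
def Form.d {p : ℕ} (η : Form E M p) : Form E M (p + 1) := fun x₀ =>
  (extDeriv (η.inChart x₀) (chartAt E x₀ x₀)).compContinuousLinearMap
    (mfderiv 𝓘(ℝ, E) 𝓘(ℝ, E) (chartAt E x₀) x₀)

variable (E M)

/-- An endomorphism `J` of the tangent bundle with `J² = -1`. (Smoothness is not a field: it is
automatic for the left-invariant structures considered below.) -/
structure AlmostComplexStructure where
  /-- the endomorphism of each tangent space -/
  toFun : (x : M) → TangentSpace 𝓘(ℝ, E) x →L[ℝ] TangentSpace 𝓘(ℝ, E) x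
  sq : ∀ (x : M) (v : TangentSpace 𝓘(ℝ, E) x), toFun x (toFun x v) = -v

variable {E M}

/-- The action of `J` on `p`-forms, `(Jη)(X₁, …, X_p) = (-1)^p η(JX₁, …, JX_p)`. -/
def AlmostComplexStructure.act (J : AlmostComplexStructure E M) {p : ℕ} (η : Form E M p) :
    Form E M p := fun x => (-1 : ℝ) ^ p • (η x).compContinuousLinearMap (J.toFun x)

/-- The inverse of the action of `J` on `p`-forms, `J⁻¹ = (-1)^p J`. -/
def AlmostComplexStructure.actInv (J : AlmostComplexStructure E M) {p : ℕ} (η : Form E M p) :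
    Form E M p := fun x => (-1 : ℝ) ^ p • J.act η x

/-- The operator `d^c = -J⁻¹ d J`. -/
def AlmostComplexStructure.dc (J : AlmostComplexStructure E M) {p : ℕ} (η : Form E M p) :
    Form E M (p + 1) := fun x => -(J.actInv (J.act η).d x)

/-- A `J`-Hermitian metric: a Riemannian metric `g` with `g(JX, JY) = g(X, Y)`. (Smoothness is not
a field: it is automatic for the left-invariant metrics considered below.) -/
structure HermitianMetric (J : AlmostComplexStructure E M) where
  /-- the bilinear form on each tangent space -/
  toFun : (x : M) → TangentSpace 𝓘(ℝ, E) x →L[ℝ] TangentSpace 𝓘(ℝ, E) x →L[ℝ] ℝ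
  symm : ∀ (x : M) (v w : TangentSpace 𝓘(ℝ, E) x), toFun x v w = toFun x w v
  pos : ∀ (x : M) (v : TangentSpace 𝓘(ℝ, E) x), v ≠ 0 → 0 < toFun x v v
  compat : ∀ (x : M) (v w : TangentSpace 𝓘(ℝ, E) x),
    toFun x (J.toFun x v) (J.toFun x w) = toFun x v w

theorem HermitianMetric.apply_J_self {J : AlmostComplexStructure E M} (g : HermitianMetric J)
    (x : M) (v : TangentSpace 𝓘(ℝ, E) x) : g.toFun x (J.toFun x v) v = 0 := by
  have h1 := g.compat x (J.toFun x v) v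
  rw [J.sq, map_neg, neg_apply, g.symm x v] at h1
  linarith

theorem continuous_bilin_apply (B : E →L[ℝ] E →L[ℝ] ℝ) :
    Continuous fun v : Fin 2 → E => B (v 0) (v 1) :=
  (B.continuous.comp (continuous_apply 0)).clm_apply (continuous_apply 1)

/-- The fundamental form `ω(X, Y) = g(JX, Y)` of a Hermitian metric. -/
def HermitianMetric.fundamentalForm {J : AlmostComplexStructure E M} (g : HermitianMetric J) :
    Form E M 2 := fun x =>
  { toFun := fun v => g.toFun x (J.toFun x (v 0)) (v 1)
    map_update_add' := by
      intro _ v i a b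
      fin_cases i <;> simp [Function.update]
    map_update_smul' := by
      intro _ v i c a
      fin_cases i <;> simp [Function.update]
    map_eq_zero_of_eq' := by
      intro v i j hv hij
      have h : v 0 = v 1 := by
        fin_cases i <;> fin_cases j <;> simp_all
      simp only [h]
      exact g.apply_J_self x (v 1)
    cont := continuous_bilin_apply (E := E) ((g.toFun x).comp (J.toFun x)) }

/-- The metric `g`, with fundamental form `ω`, on the `2n`-dimensional manifold `M` is
`k`-Gauduchon (`1 ≤ k ≤ n - 1`): `dd^c ω^k ∧ ω^{n-k-1} = 0`. -/
def HermitianMetric.IsGauduchon {J : AlmostComplexStructure E M} (g : HermitianMetric J)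
    (n k : ℕ) : Prop :=
  ∀ x : M, wedge ((J.dc fun y => wedgePow (g.fundamentalForm y) k).d x)
    (wedgePow (g.fundamentalForm x) (n - k - 1)) = 0

end Forms

/-! ### Quotients of Lie groups and left-invariant objects on them -/

section Quotient

variable {E : Type*} [NormedAddCommGroup E] [NormedSpace ℝ E]
  {G : Type*} [Group G] [TopologicalSpace G]

/-- A discrete subgroup acts properly discontinuously by left translations; this equips `Γ \ G`
(the space of orbits of `Γ` on `G`) with the quotient manifold structure of Mathlib. -/
instance properlyDiscontinuousSMul_of_discrete [IsTopologicalGroup G] [T2Space G]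
    (Γ : Subgroup G) [DiscreteTopology Γ] : ProperlyDiscontinuousSMul Γ G :=
  Γ.properlyDiscontinuousSMul_of_tendsto_cofinite
    (Γ.tendsto_coe_cofinite_of_discrete (isDiscrete_iff_discreteTopology.mpr inferInstance))

/-- The quotient `Γ \ G` of `G` by the left multiplications by elements of `Γ`. -/
abbrev LeftQuotient (Γ : Subgroup G) : Type _ := MulAction.orbitRel.Quotient Γ G

/-- The projection `G → Γ \ G`. -/
def proj (Γ : Subgroup G) (a : G) : LeftQuotient Γ := Quotient.mk _ a

variable [ChartedSpace E G]

variable (E) in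
/-- A complex structure on the Lie algebra `𝔤` of `G`: an endomorphism `J` with `J² = -1` and
`J[X, Y] - [JX, Y] - [X, JY] - J[JX, JY] = 0`. -/
structure IsLieComplexStructure
    (J : GroupLieAlgebra 𝓘(ℝ, E) G →ₗ[ℝ] GroupLieAlgebra 𝓘(ℝ, E) G) : Prop where
  sq : ∀ X, J (J X) = -X
  integrable : ∀ X Y, J ⁅X, Y⁆ - ⁅J X, Y⁆ - ⁅X, J Y⁆ - J ⁅J X, J Y⁆ = 0

variable [IsTopologicalGroup G] [T2Space G] [LocallyCompactSpace G]
  (Γ : Subgroup G) [DiscreteTopology Γ]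

/-- The image in `T_{Γa}(Γ \ G)`, under the differential of the projection, of the value at `a` of
the left-invariant vector field on `G` with value `X` at `1`. -/
def inducedVector (X : GroupLieAlgebra 𝓘(ℝ, E) G) (a : G) :
    TangentSpace 𝓘(ℝ, E) (proj Γ a) :=
  mfderiv 𝓘(ℝ, E) 𝓘(ℝ, E) (proj Γ) a (mulInvariantVectorField X a)

variable {Γ}

/-- `J` is a left-invariant complex structure on `Γ \ G`: it is induced, through the projection, by
the left-invariant endomorphism of `TG` that extends a complex structure `J₀` of the Lie algebra. -/
def IsLeftInvariantComplexStructure (J : AlmostComplexStructure E (LeftQuotient Γ)) : Prop :=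
  ∃ J₀ : GroupLieAlgebra 𝓘(ℝ, E) G →ₗ[ℝ] GroupLieAlgebra 𝓘(ℝ, E) G,
    IsLieComplexStructure E J₀ ∧
    ∀ (a : G) (X : GroupLieAlgebra 𝓘(ℝ, E) G),
      J.toFun (proj Γ a) (inducedVector Γ X a) = inducedVector Γ (J₀ X) a

/-- The metric `g` on `Γ \ G` is left-invariant: it is induced, through the projection, by the
left-invariant metric on `G` that extends a bilinear form `g₀` on the Lie algebra. -/
def HermitianMetric.IsLeftInvariant {J : AlmostComplexStructure E (LeftQuotient Γ)}
    (g : HermitianMetric J) : Prop :=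
  ∃ g₀ : GroupLieAlgebra 𝓘(ℝ, E) G →ₗ[ℝ] GroupLieAlgebra 𝓘(ℝ, E) G →ₗ[ℝ] ℝ,
    ∀ (a : G) (X Y : GroupLieAlgebra 𝓘(ℝ, E) G),
      g.toFun (proj Γ a) (inducedVector Γ X a) (inducedVector Γ Y a) = g₀ X Y

end Quotient

end

end Nilmanifold

/-!
Left-invariant forms on the quotient are determined by their values on the Lie algebra, and the
exterior derivative acts on them as a differential `δ` of alternating forms on the model space `E`:
`δ a` is the exterior derivative at the identity, in a chart, of the form with constant coefficients
`a` in the Maurer–Cartan coframe (`frameDeriv`, `d_leftForm`, `d_inducedForm`). Let `w` be the value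
of the fundamental form, and put `C = d^c w`. Two-forms are central in the exterior algebra, so the
Leibniz rule gives `d^c w^k = k C w^{k-1}` and

`dd^c w^k ∧ w^{n-k-1} = k (δC ∧ w^{n-2} - (k - 1) C ∧ δw ∧ w^{n-3})`.

The two terms are proportional. Indeed `C ∧ w^{n-2}` has codegree one, and on a
unimodular group `δ` vanishes on forms of codegree one, whence
`δC ∧ w^{n-2} = (n - 2) C ∧ δw ∧ w^{n-3}`. Therefore `dd^c w^k ∧ w^{n-k-1}` is
`k (n - k - 1) C ∧ δw ∧ w^{n-3}`. For `1 ≤ k < n - 1` the coefficient is not zero, and the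
`k`-Gauduchon condition does not depend on `k` (`wedge_dcPow_eq_zero_iff`).

Unimodularity comes from nilpotency at the level of the group. The map `x ↦ b x b⁻¹ x⁻¹` has
differential `Ad b - 1` at the identity, and its iterates go down the lower central series, so
`Ad b - 1` is nilpotent and `det (Ad b) = 1` (`det_chartAd`). Hence the left- and right-invariant
frames have the same determinant. Differentiating this equality at the identity gives the equality
of traces which says that the divergence of every left-invariant vector field is zero
(`frameDeriv_maurerCartan_eq_zero`).

To compute with forms of different degrees without casts, they are mapped into the exterior algebra
of the dual space by an injective map `toExt` that turns `wedge` into the product (`toExt_wedge`).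
-/

namespace Nilmanifold

noncomputable section

open Module Filter Topology

/-! ### Elementary properties of the exterior product -/

section WedgeBasic

variable {V W : Type*} [AddCommGroup V] [Module ℝ V] [TopologicalSpace V]
  [AddCommGroup W] [Module ℝ W] [TopologicalSpace W] {p q : ℕ}

theorem wedge_apply (a : V [⋀^Fin p]→L[ℝ] ℝ) (b : V [⋀^Fin q]→L[ℝ] ℝ) (v : Fin (p + q) → V) :
    wedge a b v = LinearMap.mul' ℝ ℝ (a.toAlternatingMap.domCoprod b.toAlternatingMap
      (v ∘ finSumFinEquiv)) := rfl

/-- The exterior product as a sum over all permutations, instead of over shuffles. -/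
theorem factorial_smul_wedge_apply (a : V [⋀^Fin p]→L[ℝ] ℝ) (b : V [⋀^Fin q]→L[ℝ] ℝ)
    (v : Fin (p + q) → V) :
    ((p.factorial * q.factorial : ℕ) : ℝ) * wedge a b v =
      ∑ σ : Equiv.Perm (Fin p ⊕ Fin q), ((Equiv.Perm.sign σ : ℤ) : ℝ) *
        (a (fun i => v (finSumFinEquiv (σ (.inl i)))) *
          b (fun i => v (finSumFinEquiv (σ (.inr i))))) := by
  have h := congrArg (fun f => LinearMap.mul' ℝ ℝ (f (v ∘ finSumFinEquiv)))
    (MultilinearMap.domCoprod_alternization_eq a.toAlternatingMap b.toAlternatingMap)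
  simp only [Fintype.card_fin, AlternatingMap.smul_apply, map_nsmul] at h
  rw [nsmul_eq_mul] at h
  rw [wedge_apply, ← h, MultilinearMap.alternatization_apply, _root_.map_sum]
  refine Finset.sum_congr rfl fun σ _ => ?_
  rcases Int.units_eq_one_or (Equiv.Perm.sign σ) with hs | hs <;> simp [hs]

theorem wedge_eq_of_forall (a : V [⋀^Fin p]→L[ℝ] ℝ) (b : V [⋀^Fin q]→L[ℝ] ℝ)
    (c : V [⋀^Fin (p + q)]→L[ℝ] ℝ)
    (h : ∀ v, ((p.factorial * q.factorial : ℕ) : ℝ) * c v =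
      ∑ σ : Equiv.Perm (Fin p ⊕ Fin q), ((Equiv.Perm.sign σ : ℤ) : ℝ) *
        (a (fun i => v (finSumFinEquiv (σ (.inl i)))) *
          b (fun i => v (finSumFinEquiv (σ (.inr i)))))) : wedge a b = c := by
  ext v
  have h1 := (factorial_smul_wedge_apply a b v).trans (h v).symm
  refine mul_left_cancel₀ ?_ h1
  exact_mod_cast (Nat.mul_pos p.factorial_pos q.factorial_pos).ne'

theorem wedge_compContinuousLinearMap (a : V [⋀^Fin p]→L[ℝ] ℝ) (b : V [⋀^Fin q]→L[ℝ] ℝ)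
    (f : W →L[ℝ] V) :
    (wedge a b).compContinuousLinearMap f =
      wedge (a.compContinuousLinearMap f) (b.compContinuousLinearMap f) := by
  refine (wedge_eq_of_forall _ _ _ fun v => ?_).symm
  rw [ContinuousAlternatingMap.compContinuousLinearMap_apply, factorial_smul_wedge_apply]
  rfl

theorem wedgePow_compContinuousLinearMap (w : V [⋀^Fin 2]→L[ℝ] ℝ) (f : W →L[ℝ] V) (k : ℕ) :
    (wedgePow w k).compContinuousLinearMap f = wedgePow (w.compContinuousLinearMap f) k := by
  induction k with
  | zero => rfl
  | succ k ih =>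
    change (wedge (wedgePow w k) w).compContinuousLinearMap f = wedge (wedgePow _ k) _
    rw [wedge_compContinuousLinearMap, ih]

/-- The exterior product as a bilinear map. -/
def wedgeₗ (V : Type*) [AddCommGroup V] [Module ℝ V] [TopologicalSpace V] (p q : ℕ) :
    (V [⋀^Fin p]→L[ℝ] ℝ) →ₗ[ℝ] (V [⋀^Fin q]→L[ℝ] ℝ) →ₗ[ℝ] (V [⋀^Fin (p + q)]→L[ℝ] ℝ) :=
  LinearMap.mk₂ ℝ wedge
    (fun a a' b => wedge_eq_of_forall _ _ _ fun v => by
      simp only [ContinuousAlternatingMap.add_apply, mul_add, factorial_smul_wedge_apply, add_mul,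
        Finset.sum_add_distrib])
    (fun c a b => wedge_eq_of_forall _ _ _ fun v => by
      simp only [ContinuousAlternatingMap.smul_apply, smul_eq_mul, mul_left_comm _ c,
        factorial_smul_wedge_apply, Finset.mul_sum, mul_assoc])
    (fun a b b' => wedge_eq_of_forall _ _ _ fun v => by
      simp only [ContinuousAlternatingMap.add_apply, mul_add, factorial_smul_wedge_apply,
        Finset.sum_add_distrib])
    (fun c a b => wedge_eq_of_forall _ _ _ fun v => by
      simp only [ContinuousAlternatingMap.smul_apply, smul_eq_mul, mul_left_comm _ c,
        factorial_smul_wedge_apply, Finset.mul_sum])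

end WedgeBasic

/-! ### Alternating forms as elements of the exterior algebra of the dual space -/

section ExteriorAlgebra

variable {E : Type*} [NormedAddCommGroup E] [NormedSpace ℝ E] [FiniteDimensional ℝ E] {p q : ℕ}

variable (E) in
/-- The algebra in which the alternating forms of all degrees on `E` are multiplied. -/
abbrev FormAlgebra : Type _ := ExteriorAlgebra ℝ (Dual ℝ E)

/-- The coordinate one-forms of the chosen basis of `E`, extended multiplicatively to tuples. -/
def coordMulti {p : ℕ} (I : Fin p → Fin (finrank ℝ E)) : FormAlgebra E :=
  ExteriorAlgebra.ιMulti ℝ p fun r => (finBasis ℝ E).coord (I r)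

/-- The element `(p!)⁻¹ ∑ a(e_{i₁}, …, e_{i_p}) e^{i₁} ⋯ e^{i_p}` of the exterior algebra of `E*`
that corresponds to the alternating form `a`. Working in one algebra, rather than with the forms
themselves, removes the degrees from the types, so that associativity and commutation rules can be
stated without casts. -/
def toExt {p : ℕ} (a : E [⋀^Fin p]→L[ℝ] ℝ) : FormAlgebra E :=
  ((p.factorial : ℝ))⁻¹ • ∑ I : Fin p → Fin (finrank ℝ E),
    a (fun r => finBasis ℝ E (I r)) • coordMulti I

theorem factorial_smul_toExt (a : E [⋀^Fin p]→L[ℝ] ℝ) :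
    (p.factorial : ℝ) • toExt a = ∑ I : Fin p → Fin (finrank ℝ E),
      a (fun r => finBasis ℝ E (I r)) • coordMulti I := by
  rw [toExt, smul_inv_smul₀ (by exact_mod_cast p.factorial_ne_zero)]

theorem toExt_add (a b : E [⋀^Fin p]→L[ℝ] ℝ) : toExt (a + b) = toExt a + toExt b := by
  simp only [toExt, ContinuousAlternatingMap.add_apply, add_smul, Finset.sum_add_distrib, smul_add]

theorem toExt_smul (c : ℝ) (a : E [⋀^Fin p]→L[ℝ] ℝ) : toExt (c • a) = c • toExt a := by
  simp only [toExt, ContinuousAlternatingMap.smul_apply, smul_eq_mul, mul_smul]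
  rw [← Finset.smul_sum, smul_comm]

theorem toExt_zero : toExt (0 : E [⋀^Fin p]→L[ℝ] ℝ) = 0 := by
  simpa using toExt_smul (0 : ℝ) (0 : E [⋀^Fin p]→L[ℝ] ℝ)

theorem apply_eq_sum_coord (a : E [⋀^Fin p]→L[ℝ] ℝ) (v : Fin p → E) :
    a v = ∑ I : Fin p → Fin (finrank ℝ E),
      (∏ r, (finBasis ℝ E).coord (I r) (v r)) * a (fun r => finBasis ℝ E (I r)) := by
  conv_lhs => rw [show v = fun r => ∑ i, (finBasis ℝ E).coord i (v r) • finBasis ℝ E i from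
    funext fun r => ((finBasis ℝ E).sum_repr (v r)).symm]
  rw [ContinuousAlternatingMap.map_sum]
  refine Finset.sum_congr rfl fun I _ => ?_
  rw [ContinuousAlternatingMap.map_smul_univ, smul_eq_mul]

/-- Evaluation of a form at `v` factors through `toExt`, which makes `toExt` injective: on a product
of `p` one-forms it is the determinant of their values on `v`. -/
theorem toExt_injective : Function.Injective (toExt : (E [⋀^Fin p]→L[ℝ] ℝ) → FormAlgebra E) := by
  intro a b hab
  ext v
  let D : (Dual ℝ E) [⋀^Fin p]→ₗ[ℝ] ℝ := Matrix.detRowAlternating.compLinearMap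
    (LinearMap.pi fun s => Dual.eval ℝ E (v s))
  let ev : FormAlgebra E →ₗ[ℝ] ℝ := ExteriorAlgebra.liftAlternating (Pi.single p D)
  have hev (c : E [⋀^Fin p]→L[ℝ] ℝ) : (p.factorial : ℝ) * ev (toExt c) = p.factorial * c v := by
    rw [← smul_eq_mul, ← map_smul, factorial_smul_toExt, _root_.map_sum]
    have h1 (I : Fin p → Fin (finrank ℝ E)) : ev (coordMulti I) =
        ∑ σ : Equiv.Perm (Fin p), ((Equiv.Perm.sign σ : ℤ) : ℝ) *
          ∏ r, (finBasis ℝ E).coord (I r) (v (σ r)) := by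
      have : ev (coordMulti I) = D fun r => (finBasis ℝ E).coord (I r) := by
        simp only [ev, coordMulti, ExteriorAlgebra.liftAlternating_apply_ιMulti, Pi.single_eq_same]
      rw [this]
      change Matrix.det (Matrix.of fun r s => (finBasis ℝ E).coord (I r) (v s)) = _
      rw [← Matrix.det_transpose, Matrix.det_apply']
      rfl
    simp only [map_smul, h1, smul_eq_mul, Finset.mul_sum]
    rw [Finset.sum_comm]
    have h2 (σ : Equiv.Perm (Fin p)) : (∑ I : Fin p → Fin (finrank ℝ E),
        c (fun r => finBasis ℝ E (I r)) * (((Equiv.Perm.sign σ : ℤ) : ℝ) *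
          ∏ r, (finBasis ℝ E).coord (I r) (v (σ r)))) = c v := by
      have h3 : c (v ∘ σ) = ((Equiv.Perm.sign σ : ℤ) : ℝ) * c v := by
        have := c.toAlternatingMap.map_perm v σ
        simpa [Units.smul_def] using this
      have h4 : c v = ((Equiv.Perm.sign σ : ℤ) : ℝ) * c (v ∘ σ) := by
        rw [h3, ← mul_assoc]
        rcases Int.units_eq_one_or (Equiv.Perm.sign σ) with hs | hs <;> simp [hs]
      rw [h4, apply_eq_sum_coord c (v ∘ σ), Finset.mul_sum]
      refine Finset.sum_congr rfl fun I _ => ?_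
      simp only [Function.comp]
      ring
    rw [Finset.sum_congr rfl fun σ _ => h2 σ, Finset.sum_const, Finset.card_univ,
      Fintype.card_perm, Fintype.card_fin, nsmul_eq_mul]
  have h := (hev a).symm.trans ((congrArg (fun t => (p.factorial : ℝ) * ev t) hab).trans (hev b))
  exact mul_left_cancel₀ (by exact_mod_cast p.factorial_ne_zero) h

theorem toExt_eq_zero_iff (a : E [⋀^Fin p]→L[ℝ] ℝ) : toExt a = 0 ↔ a = 0 :=
  ⟨fun h => toExt_injective (h.trans toExt_zero.symm), fun h => h ▸ toExt_zero⟩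

theorem coordMulti_comp_perm (I : Fin p → Fin (finrank ℝ E)) (σ : Equiv.Perm (Fin p)) :
    coordMulti (E := E) (I ∘ σ) = ((Equiv.Perm.sign σ : ℤ) : ℝ) • coordMulti I := by
  have := (ExteriorAlgebra.ιMulti ℝ p).map_perm
    (fun r => ((finBasis ℝ E).coord (I r) : Dual ℝ E)) σ
  rw [Units.smul_def, ← Int.cast_smul_eq_zsmul ℝ] at this
  exact this

/-- When `wedge` is written as a sum over all permutations, each permutation contributes the same
element, since reordering the one-forms and reindexing produce the same sign. -/
theorem toExt_wedge (a : E [⋀^Fin p]→L[ℝ] ℝ) (b : E [⋀^Fin q]→L[ℝ] ℝ) :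
    toExt (wedge a b) = toExt a * toExt b := by
  have hpq : ((p.factorial * q.factorial : ℕ) : ℝ) ≠ 0 := by
    exact_mod_cast (Nat.mul_pos p.factorial_pos q.factorial_pos).ne'
  have hs : (((p + q).factorial : ℕ) : ℝ) ≠ 0 := by exact_mod_cast (p + q).factorial_ne_zero
  have hprod : ((p.factorial * q.factorial : ℕ) : ℝ) • (toExt a * toExt b) =
      ∑ I : Fin (p + q) → Fin (finrank ℝ E),
        (a (fun r => finBasis ℝ E (I (finSumFinEquiv (.inl r)))) *
          b (fun r => finBasis ℝ E (I (finSumFinEquiv (.inr r))))) • coordMulti I := by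
    rw [Nat.cast_mul, mul_smul, ← mul_smul_comm, ← smul_mul_assoc, factorial_smul_toExt,
      factorial_smul_toExt, Finset.sum_mul_sum, ← Fintype.sum_prod_type']
    refine Fintype.sum_equiv (Fin.appendEquiv p q) _ _ fun x => ?_
    obtain ⟨I, J⟩ := x
    simp only [Fin.appendEquiv, Equiv.coe_fn_mk, finSumFinEquiv_apply_left,
      finSumFinEquiv_apply_right, Fin.append_left, Fin.append_right]
    rw [smul_mul_smul_comm, coordMulti, coordMulti, ExteriorAlgebra.ιMulti_mul_ιMulti, coordMulti]
    congr 2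
    funext r
    refine Fin.addCases (fun i => ?_) (fun i => ?_) r <;> simp
  have hperm (σ : Equiv.Perm (Fin p ⊕ Fin q)) :
      ∑ I : Fin (p + q) → Fin (finrank ℝ E), (((Equiv.Perm.sign σ : ℤ) : ℝ) *
        (a (fun r => finBasis ℝ E (I (finSumFinEquiv (σ (.inl r))))) *
          b (fun r => finBasis ℝ E (I (finSumFinEquiv (σ (.inr r))))))) • coordMulti (E := E) I =
      ((p.factorial * q.factorial : ℕ) : ℝ) • (toExt a * toExt b) := by
    rw [hprod]
    let τ : Equiv.Perm (Fin (p + q)) := finSumFinEquiv.permCongr σ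
    refine Fintype.sum_equiv (τ.symm.arrowCongr (Equiv.refl _)) _ _ fun I => ?_
    have h1 : (τ.symm.arrowCongr (Equiv.refl (Fin (finrank ℝ E)))) I = I ∘ τ := by
      funext r; simp [Equiv.arrowCongr]
    rw [h1, coordMulti_comp_perm, smul_smul, mul_comm]
    have h2 : Equiv.Perm.sign τ = Equiv.Perm.sign σ := Equiv.Perm.sign_permCongr _ _
    simp only [h2, Function.comp, τ, Equiv.permCongr_apply, Equiv.symm_apply_apply]
  have key : (((p + q).factorial : ℕ) : ℝ) • ((p.factorial * q.factorial : ℕ) : ℝ) •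
      toExt (wedge a b) = (((p + q).factorial : ℕ) : ℝ) •
      ((p.factorial * q.factorial : ℕ) : ℝ) • (toExt a * toExt b) := by
    rw [smul_comm, factorial_smul_toExt, Finset.smul_sum]
    simp only [smul_smul, factorial_smul_wedge_apply, Finset.sum_smul]
    rw [Finset.sum_comm]
    have := Finset.sum_congr (rfl : (Finset.univ : Finset (Equiv.Perm (Fin p ⊕ Fin q))) = _)
      fun σ _ => hperm σ
    refine this.trans ?_
    rw [Finset.sum_const, Finset.card_univ, Fintype.card_perm, Fintype.card_sum, Fintype.card_fin,
      Fintype.card_fin, ← Nat.cast_smul_eq_nsmul ℝ, smul_smul]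
  exact smul_right_injective _ hpq (smul_right_injective _ hs key)

theorem toExt_wedgePow (w : E [⋀^Fin 2]→L[ℝ] ℝ) (k : ℕ) : toExt (wedgePow w k) = toExt w ^ k := by
  induction k with
  | zero => simp [toExt, wedgePow, coordMulti]
  | succ k ih =>
    change toExt (wedge (wedgePow w k) w) = _
    rw [toExt_wedge, ih, pow_succ]

/-- In the exterior algebra, alternating the derivative of a family of forms is multiplication by
the coordinate one-forms. -/
theorem toExt_alternatizeUncurryFin (A : E →L[ℝ] E [⋀^Fin p]→L[ℝ] ℝ) :
    toExt (.alternatizeUncurryFin A) = ∑ i, ExteriorAlgebra.ι ℝ ((finBasis ℝ E).coord i) *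
      toExt (A (finBasis ℝ E i)) := by
  have hp : (((p + 1).factorial : ℕ) : ℝ) ≠ 0 := by exact_mod_cast (p + 1).factorial_ne_zero
  refine smul_right_injective _ hp ?_
  change (((p + 1).factorial : ℕ) : ℝ) • _ = (((p + 1).factorial : ℕ) : ℝ) • _
  rw [factorial_smul_toExt]
  simp only [ContinuousAlternatingMap.alternatizeUncurryFin_apply, Finset.sum_smul]
  rw [Finset.sum_comm]
  have h (r : Fin (p + 1)) : ∑ I : Fin (p + 1) → Fin (finrank ℝ E),
      ((-1 : ℤ) ^ (r : ℕ) • A (finBasis ℝ E (I r)) (r.removeNth fun s => finBasis ℝ E (I s))) •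
        coordMulti (E := E) I =
      (p.factorial : ℝ) • ∑ i, ExteriorAlgebra.ι ℝ ((finBasis ℝ E).coord i) *
        toExt (A (finBasis ℝ E i)) := by
    simp only [Finset.smul_sum, ← mul_smul_comm, factorial_smul_toExt, Finset.mul_sum]
    rw [← Fintype.sum_prod_type']
    refine Fintype.sum_equiv (Fin.insertNthEquiv (fun _ => Fin (finrank ℝ E)) r).symm _ _
      fun I => ?_
    have h1 : coordMulti (E := E) I = (-1 : ℤ) ^ (r : ℕ) •
        (ExteriorAlgebra.ι ℝ ((finBasis ℝ E).coord (I r)) * coordMulti (r.removeNth I)) := by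
      have := (ExteriorAlgebra.ιMulti ℝ (p + 1)).map_insertNth r
        ((finBasis ℝ E).coord (I r) : Dual ℝ E) fun s => (finBasis ℝ E).coord (r.removeNth I s)
      have hcons (x : Dual ℝ E) (f : Fin p → Dual ℝ E) : ExteriorAlgebra.ιMulti ℝ (p + 1)
          (Matrix.vecCons x f) = ExteriorAlgebra.ι ℝ x * ExteriorAlgebra.ιMulti ℝ p f := by
        rw [ExteriorAlgebra.ιMulti_succ_apply]
        rfl
      rw [hcons] at this
      refine Eq.trans ?_ this
      refine congrArg (ExteriorAlgebra.ιMulti ℝ (p + 1)) ?_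
      rw [← Fin.insertNth_self_removeNth r fun s => ((finBasis ℝ E).coord (I s) : Dual ℝ E)]
      rfl
    rw [h1]
    simp only [Fin.insertNthEquiv, Equiv.coe_fn_symm_mk, mul_smul_comm]
    rw [smul_assoc, smul_comm (_ : ℝ) ((-1 : ℤ) ^ (r : ℕ)), smul_smul, ← mul_pow]
    simp
    rfl
  rw [Finset.sum_congr rfl fun r _ => h r, Finset.sum_const, Finset.card_univ, Fintype.card_fin,
    ← Nat.cast_smul_eq_nsmul ℝ, smul_smul, Nat.factorial_succ, Nat.cast_mul]

theorem ι_mul_toExt (x : Dual ℝ E) (a : E [⋀^Fin p]→L[ℝ] ℝ) :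
    ExteriorAlgebra.ι ℝ x * toExt a = (-1 : ℝ) ^ p • (toExt a * ExteriorAlgebra.ι ℝ x) := by
  have h (q : ℕ) (f : Fin q → Dual ℝ E) : ExteriorAlgebra.ι ℝ x * ExteriorAlgebra.ιMulti ℝ q f =
      (-1 : ℝ) ^ q • (ExteriorAlgebra.ιMulti ℝ q f * ExteriorAlgebra.ι ℝ x) := by
    induction q with
    | zero => simp
    | succ q ih =>
      rw [ExteriorAlgebra.ιMulti_succ_apply, ← mul_assoc,
        eq_neg_of_add_eq_zero_left (ExteriorAlgebra.ι_add_mul_swap x (f 0)), neg_mul, mul_assoc,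
        ih, mul_smul_comm, pow_succ, mul_smul, neg_one_smul, smul_neg, mul_assoc]
  simp only [toExt, mul_smul_comm, smul_mul_assoc, Finset.mul_sum, Finset.sum_mul, coordMulti, h,
    Finset.smul_sum]
  refine Finset.sum_congr rfl fun I _ => ?_
  rw [smul_comm _ ((-1 : ℝ) ^ p), smul_comm _ ((-1 : ℝ) ^ p)]

/-- Forms of even degree are central. -/
theorem toExt_commute (hp : Even p) (a : E [⋀^Fin p]→L[ℝ] ℝ) (b : E [⋀^Fin q]→L[ℝ] ℝ) :
    Commute (toExt a) (toExt b) := by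
  have h (x : Dual ℝ E) : Commute (toExt a) (ExteriorAlgebra.ι ℝ x) := by
    have := ι_mul_toExt x a
    rw [hp.neg_one_pow, one_smul] at this
    exact this.symm
  rw [toExt]
  refine Commute.smul_right (Commute.sum_right _ _ _ fun I _ => Commute.smul_right ?_ _) _
  rw [coordMulti, ExteriorAlgebra.ιMulti_apply]
  refine Commute.list_prod_right _ _ fun y hy => ?_
  obtain ⟨i, rfl⟩ := List.mem_ofFn.1 hy
  exact h _

/-- The algebraic form of the Leibniz rule. -/
theorem toExt_alternatizeUncurryFin_wedge (a : E [⋀^Fin p]→L[ℝ] ℝ) (b : E [⋀^Fin q]→L[ℝ] ℝ)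
    (A : E →L[ℝ] E [⋀^Fin p]→L[ℝ] ℝ) (B : E →L[ℝ] E [⋀^Fin q]→L[ℝ] ℝ)
    (C : E →L[ℝ] E [⋀^Fin (p + q)]→L[ℝ] ℝ) (hC : ∀ v, C v = wedge a (B v) + wedge (A v) b) :
    toExt (.alternatizeUncurryFin C) = toExt (.alternatizeUncurryFin A) * toExt b +
      (-1 : ℝ) ^ p • (toExt a * toExt (.alternatizeUncurryFin B)) := by
  simp only [toExt_alternatizeUncurryFin, hC, toExt_add, toExt_wedge, mul_add, Finset.sum_mul,
    Finset.mul_sum, Finset.smul_sum, Finset.sum_add_distrib, ← mul_assoc]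
  rw [add_comm]
  congr 1
  refine Finset.sum_congr rfl fun i _ => ?_
  rw [ι_mul_toExt, smul_mul_assoc]

end ExteriorAlgebra

/-! ### Forms of top degree and traces -/

section Trace

variable {E : Type*} [NormedAddCommGroup E] [NormedSpace ℝ E] [FiniteDimensional ℝ E] {p q : ℕ}

/-- The space of alternating forms of degree `p` embeds into the dual of the `p`-th
exterior power. -/
def toExteriorPowerDual (E : Type*) [NormedAddCommGroup E] [NormedSpace ℝ E] (p : ℕ) :
    (E [⋀^Fin p]→L[ℝ] ℝ) →ₗ[ℝ] (⋀[ℝ]^p E →ₗ[ℝ] ℝ) :=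
  exteriorPower.alternatingMapLinearEquiv.toLinearMap ∘ₗ
    ContinuousAlternatingMap.toAlternatingMapLinear (R := ℝ)

omit [FiniteDimensional ℝ E] in
theorem toExteriorPowerDual_injective : Function.Injective (toExteriorPowerDual E p) :=
  exteriorPower.alternatingMapLinearEquiv.injective.comp
    ContinuousAlternatingMap.toAlternatingMap_injective

instance finiteDimensional_continuousAlternatingMap : FiniteDimensional ℝ (E [⋀^Fin p]→L[ℝ] ℝ) :=
  FiniteDimensional.of_injective _ toExteriorPowerDual_injective

theorem finrank_continuousAlternatingMap_le :
    finrank ℝ (E [⋀^Fin p]→L[ℝ] ℝ) ≤ (finrank ℝ E).choose p := by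
  refine (LinearMap.finrank_le_finrank_of_injective toExteriorPowerDual_injective).trans ?_
  rw [← exteriorPower.finrank_eq ℝ p]
  exact (Subspace.dual_finrank_eq (K := ℝ) (V := ⋀[ℝ]^p E)).le

/-- The determinant with respect to a basis, as a continuous form of top degree. -/
def volForm {ι : Type*} [Fintype ι] [DecidableEq ι] (b : Basis ι ℝ E) : E [⋀^ι]→L[ℝ] ℝ :=
  { b.det with
    cont := by
      change Continuous fun v : ι → E => Matrix.det (Matrix.of fun i j => b.coord i (v j))
      refine Continuous.matrix_det (continuous_matrix fun i j => ?_)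
      exact (b.coord i).continuous_of_finiteDimensional.comp (continuous_apply j) }

theorem volForm_apply {ι : Type*} [Fintype ι] [DecidableEq ι] (b : Basis ι ℝ E) (v : ι → E) :
    volForm b v = b.det v := rfl

theorem volForm_update {ι : Type*} [Fintype ι] [DecidableEq ι] (b : Basis ι ℝ E) (i : ι) (x : E) :
    volForm b (Function.update b i x) = b.coord i x := by
  have h := LinearMap.congr_fun
    (b.det_smul_mk_coord_eq_det_update b.linearIndependent b.span_eq.ge i) x
  rw [b.det_self, one_smul] at h
  rw [volForm_apply]
  refine Eq.trans h.symm ?_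
  congr 2
  ext j
  simp

omit [FiniteDimensional ℝ E] in
theorem trace_eq_sum_coord {ι : Type*} [Fintype ι] [DecidableEq ι] (b : Basis ι ℝ E)
    (T : E →L[ℝ] E) : LinearMap.trace ℝ E T = ∑ i, b.coord i (T (b i)) := by
  rw [LinearMap.trace_eq_matrix_trace ℝ b, Matrix.trace]
  simp [LinearMap.toMatrix_apply]

omit [FiniteDimensional ℝ E] in
theorem eq_of_apply_basis_eq {ι : Type*} [Fintype ι] [DecidableEq ι] (b : Basis ι ℝ E)
    {f g : E [⋀^ι]→L[ℝ] ℝ} (h : f b = g b) : f = g := by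
  refine ContinuousAlternatingMap.toAlternatingMap_injective ?_
  rw [f.toAlternatingMap.eq_smul_basis_det b, g.toAlternatingMap.eq_smul_basis_det b]
  exact congrArg (· • b.det) h

/-- The infinitesimal form of `f^* vol = det f · vol`. -/
theorem fderivComp_volForm {ι : Type*} [Fintype ι] [DecidableEq ι] (b : Basis ι ℝ E)
    (T : E →L[ℝ] E) :
    (volForm b).fderivCompContinuousLinearMap (.id ℝ E) T =
      LinearMap.trace ℝ E T • volForm b := by
  refine eq_of_apply_basis_eq b ?_
  rw [ContinuousAlternatingMap.fderivCompContinuousLinearMap_apply,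
    ContinuousAlternatingMap.smul_apply, volForm_apply b b, b.det_self, smul_eq_mul, mul_one,
    trace_eq_sum_coord b]
  refine Finset.sum_congr rfl fun i _ => ?_
  rw [← volForm_update]
  congr 1
  ext j
  by_cases h : j = i
  · subst h; simp
  · simp [h]

/-- `∑ eⁱ ∧ ι_{T e_i} vol = tr T · vol`. -/
theorem alternatizeUncurryFin_volForm (b : Basis (Fin (p + 1)) ℝ E) (T : E →L[ℝ] E) :
    ContinuousAlternatingMap.alternatizeUncurryFin ((volForm b).curryLeft ∘L T) =
      LinearMap.trace ℝ E T • volForm b := by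
  refine eq_of_apply_basis_eq b ?_
  rw [ContinuousAlternatingMap.alternatizeUncurryFin_apply,
    ContinuousAlternatingMap.smul_apply, volForm_apply b b, b.det_self, smul_eq_mul, mul_one,
    trace_eq_sum_coord b]
  refine Finset.sum_congr rfl fun i _ => ?_
  rw [← volForm_update, ← Fin.insertNth_removeNth, ContinuousAlternatingMap.map_insertNth]
  rfl

/-- Every form of codegree one is the contraction of the volume form with a vector, because the
space of these forms has dimension at most `dim E`. -/
theorem exists_eq_curryLeft_volForm (b : Basis (Fin (p + 1)) ℝ E) (a : E [⋀^Fin p]→L[ℝ] ℝ) :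
    ∃ X : E, a = (volForm b).curryLeft X := by
  have hinj : Function.Injective ((volForm b).curryLeft : E →ₗ[ℝ] E [⋀^Fin p]→L[ℝ] ℝ) := by
    refine (injective_iff_map_eq_zero _).2 fun X hX => ?_
    refine b.ext_elem fun i => ?_
    have h : volForm b (Matrix.vecCons X (i.removeNth b)) = 0 :=
      congrArg (fun f : E [⋀^Fin p]→L[ℝ] ℝ => f (i.removeNth b)) hX
    rw [_root_.map_zero, Finsupp.zero_apply]
    refine (volForm_update b i X).symm.trans ?_
    rw [← Fin.insertNth_removeNth, ContinuousAlternatingMap.map_insertNth, h, smul_zero]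
  -- Contraction is injective, so the dimension count makes it surjective.
  have hE : finrank ℝ E = p + 1 := by simpa using finrank_eq_card_basis b
  have hle : finrank ℝ (E [⋀^Fin p]→L[ℝ] ℝ) ≤ finrank ℝ E := by
    refine finrank_continuousAlternatingMap_le.trans ?_
    rw [hE, Nat.choose_succ_self_right]
  have hsurj := (LinearMap.injective_iff_surjective_of_finrank_eq_finrank
    (le_antisymm (LinearMap.finrank_le_finrank_of_injective hinj) hle)).1 hinj
  obtain ⟨X, hX⟩ := hsurj a
  exact ⟨X, hX.symm⟩

/-- The differential of the determinant at the identity is the trace. -/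
theorem hasFDerivAt_det {F : Type*} [NormedAddCommGroup F] [NormedSpace ℝ F]
    {lam : F → E →L[ℝ] E} {lam' : F →L[ℝ] E →L[ℝ] E} {e : F} (h : HasFDerivAt lam lam' e)
    (he : lam e = .id ℝ E) :
    ∃ D : F →L[ℝ] ℝ, HasFDerivAt (fun y => LinearMap.det (lam y : E →ₗ[ℝ] E)) D e ∧
      ∀ v, D v = LinearMap.trace ℝ E (lam' v) := by
  classical
  let b := finBasis ℝ E
  have h1 := (((hasFDerivAt_const (volForm b) e).continuousAlternatingMapCompContinuousLinearMap
    h).continuousAlternatingMap_apply_const b)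
  refine ⟨_, h1.congr_of_eventuallyEq (Filter.Eventually.of_forall fun y => ?_), fun v => ?_⟩
  · have := b.det_comp (lam y : E →ₗ[ℝ] E) b
    rw [b.det_self, mul_one] at this
    exact this.symm
  · have h2 := congrArg (fun f : E [⋀^Fin (finrank ℝ E)]→L[ℝ] ℝ => f b)
      (fderivComp_volForm b (lam' v))
    have h3 : (LinearMap.trace ℝ E (lam' v) • volForm b) b = LinearMap.trace ℝ E (lam' v) := by
      rw [ContinuousAlternatingMap.smul_apply, volForm_apply, b.det_self, smul_eq_mul, mul_one]
    rw [← h3, ← h2, ← he]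
    simp

end Trace

/-! ### The exterior derivative in a moving frame -/

section FrameDeriv

variable {E : Type*} [NormedAddCommGroup E] [NormedSpace ℝ E] {p q : ℕ}

/-- The exterior derivative at `e` of the form with constant coefficients `a` in the moving coframe
`θ`. When `θ` is the Maurer–Cartan form of a Lie group, read in a chart, this is the
Chevalley–Eilenberg differential. -/
def frameDeriv (θ : E → E →L[ℝ] E) (e : E) (a : E [⋀^Fin p]→L[ℝ] ℝ) : E [⋀^Fin (p + 1)]→L[ℝ] ℝ :=
  extDeriv (fun y => a.compContinuousLinearMap (θ y)) e

theorem hasFDerivAt_frame {θ : E → E →L[ℝ] E} {θ' : E →L[ℝ] E →L[ℝ] E} {e : E}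
    (h : HasFDerivAt θ θ' e) (he : θ e = .id ℝ E) (a : E [⋀^Fin p]→L[ℝ] ℝ) :
    HasFDerivAt (fun y => a.compContinuousLinearMap (θ y))
      (a.fderivCompContinuousLinearMap (.id ℝ E) ∘L θ') e := by
  refine ((hasFDerivAt_const a e).continuousAlternatingMapCompContinuousLinearMap h).congr_fderiv ?_
  rw [he, ContinuousLinearMap.comp_zero, zero_add]

theorem frameDeriv_eq {θ : E → E →L[ℝ] E} {θ' : E →L[ℝ] E →L[ℝ] E} {e : E}
    (h : HasFDerivAt θ θ' e) (he : θ e = .id ℝ E) (a : E [⋀^Fin p]→L[ℝ] ℝ) :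
    frameDeriv θ e a =
      .alternatizeUncurryFin (a.fderivCompContinuousLinearMap (.id ℝ E) ∘L θ') := by
  rw [frameDeriv, extDeriv, (hasFDerivAt_frame h he a).fderiv]

theorem frameDeriv_smul (θ : E → E →L[ℝ] E) (e : E) (c : ℝ) (a : E [⋀^Fin p]→L[ℝ] ℝ) :
    frameDeriv θ e (c • a) = c • frameDeriv θ e a :=
  extDeriv_smul c fun y => a.compContinuousLinearMap (θ y)

variable [FiniteDimensional ℝ E]

/-- The Leibniz rule for the exterior derivative. -/
theorem toExt_frameDeriv_wedge {θ : E → E →L[ℝ] E} {e : E} (h : DifferentiableAt ℝ θ e)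
    (he : θ e = .id ℝ E) (a : E [⋀^Fin p]→L[ℝ] ℝ) (b : E [⋀^Fin q]→L[ℝ] ℝ) :
    toExt (frameDeriv θ e (wedge a b)) = toExt (frameDeriv θ e a) * toExt b +
      (-1 : ℝ) ^ p • (toExt a * toExt (frameDeriv θ e b)) := by
  have ha := hasFDerivAt_frame h.hasFDerivAt he a
  have hb := hasFDerivAt_frame h.hasFDerivAt he b
  have hab := (wedgeₗ E p q).toContinuousBilinearMap.hasFDerivAt_of_bilinear ha hb
  rw [frameDeriv_eq h.hasFDerivAt he a, frameDeriv_eq h.hasFDerivAt he b]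
  have h1 : frameDeriv θ e (wedge a b) = .alternatizeUncurryFin (fderiv ℝ (fun y =>
      (wedgeₗ E p q).toContinuousBilinearMap (a.compContinuousLinearMap (θ y))
        (b.compContinuousLinearMap (θ y))) e) := by
    rw [frameDeriv, extDeriv]
    congr 2
    funext y
    exact wedge_compContinuousLinearMap a b (θ y)
  rw [h1, hab.fderiv]
  refine toExt_alternatizeUncurryFin_wedge a b _ _ _ fun v => ?_
  have hid {r : ℕ} (c : E [⋀^Fin r]→L[ℝ] ℝ) : c.compContinuousLinearMap (θ e) = c := by
    rw [he]; rfl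
  simp only [hid]
  rfl

/-- In codegree one the derivative is a divergence: writing the form as `ι_X vol`, it is
`(-tr λ'(X) + tr (v ↦ λ'(v) X)) vol`, where the frame `λ` is dual to the coframe `θ`. -/
theorem frameDeriv_eq_zero {θ : E → E →L[ℝ] E} {θ' : E →L[ℝ] E →L[ℝ] E} {e : E}
    (h : HasFDerivAt θ θ' e) (he : θ e = .id ℝ E)
    (htr : ∀ X, LinearMap.trace ℝ E (θ' X) = LinearMap.trace ℝ E (θ'.flip X))
    (hp : finrank ℝ E = p + 1) (a : E [⋀^Fin p]→L[ℝ] ℝ) : frameDeriv θ e a = 0 := by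
  let b := finBasisOfFinrankEq ℝ E hp
  obtain ⟨X, rfl⟩ := exists_eq_curryLeft_volForm b a
  have hcurry (T : E →L[ℝ] E) :
      ((volForm b).curryLeft X).fderivCompContinuousLinearMap (.id ℝ E) T =
        LinearMap.trace ℝ E T • (volForm b).curryLeft X - (volForm b).curryLeft (T X) := by
    ext w
    have h1 := congrArg (fun f : E [⋀^Fin (p + 1)]→L[ℝ] ℝ => f (Matrix.vecCons X w))
      (fderivComp_volForm b T)
    simp only [ContinuousAlternatingMap.fderivCompContinuousLinearMap_apply,
      ContinuousAlternatingMap.smul_apply, Fin.sum_univ_succ] at h1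
    simp only [ContinuousAlternatingMap.sub_apply, ContinuousAlternatingMap.smul_apply,
      ContinuousAlternatingMap.curryLeft_apply_apply, ← h1,
      ContinuousAlternatingMap.fderivCompContinuousLinearMap_apply]
    rw [eq_sub_iff_add_eq, add_comm]
    congr 1
    · congr 1
      ext j
      refine Fin.cases ?_ (fun j => ?_) j <;> simp
    · refine Finset.sum_congr rfl fun i _ => ?_
      congr 1
      ext j
      refine Fin.cases ?_ (fun j => ?_) j
      · simp [Function.update_of_ne (Fin.succ_ne_zero i).symm]
      · by_cases hij : j = i
        · subst hij; simp
        · simp [hij]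
  -- The derivative of `ι_X vol` splits into `v ↦ tr θ'(v) · ι_X vol` and `v ↦ ι_{θ'(v) X} vol`.
  let φ : E →L[ℝ] ℝ := (LinearMap.trace ℝ E ∘ₗ ContinuousLinearMap.coeLM ℝ ∘ₗ
    (θ' : E →ₗ[ℝ] E →L[ℝ] E)).toContinuousLinearMap
  have hφ (v : E) : φ v = LinearMap.trace ℝ E (θ' v) := rfl
  have hD : ((volForm b).curryLeft X).fderivCompContinuousLinearMap (.id ℝ E) ∘L θ' =
      (volForm b).curryLeft ∘L φ.smulRight X - (volForm b).curryLeft ∘L θ'.flip X := by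
    ext1 v
    simp only [ContinuousLinearMap.comp_apply, hcurry, sub_apply, hφ,
      ContinuousLinearMap.smulRight_apply, ContinuousLinearMap.flip_apply, map_smul]
  have htrφ : LinearMap.trace ℝ E (φ.smulRight X : E →L[ℝ] E) = φ X :=
    LinearMap.trace_smulRight (φ : E →ₗ[ℝ] ℝ) X
  have hsub := map_sub (ContinuousAlternatingMap.alternatizeUncurryFinCLM ℝ E ℝ (n := p))
    ((volForm b).curryLeft ∘L φ.smulRight X) ((volForm b).curryLeft ∘L θ'.flip X)
  simp only [ContinuousAlternatingMap.alternatizeUncurryFinCLM_apply] at hsub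
  rw [frameDeriv_eq h he, hD, hsub, alternatizeUncurryFin_volForm, alternatizeUncurryFin_volForm,
    htrφ, hφ, htr, sub_self]

end FrameDeriv

/-! ### Differentials and exterior derivatives in charts -/

section Charts

variable {E : Type*} [NormedAddCommGroup E] [NormedSpace ℝ E]
  {M N P : Type*} [TopologicalSpace M] [ChartedSpace E M] [TopologicalSpace N] [ChartedSpace E N]
  [TopologicalSpace P] [ChartedSpace E P] {p : ℕ}

variable (E) in
/-- The differential of `f` at `x` as an endomorphism of the model space, which every tangent space
is by definition. -/
def mderiv (f : M → N) (x : M) : E →L[ℝ] E := mfderiv 𝓘(ℝ, E) 𝓘(ℝ, E) f x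

theorem mderiv_eq_fderiv {f : M → N} {x : M} (hf : MDifferentiableAt 𝓘(ℝ, E) 𝓘(ℝ, E) f x)
    {y : N} (hy : f x = y) :
    mderiv E f x = fderiv ℝ (fun z => chartAt E y (f ((chartAt E x).symm z))) (chartAt E x x) := by
  subst hy
  refine hf.mfderiv.trans ?_
  simp only [writtenInExtChartAt, mfld_simps, fderivWithin_univ]
  rfl

theorem mderiv_comp {g : N → P} {f : M → N} {x : M} {y : N}
    (hg : MDifferentiableAt 𝓘(ℝ, E) 𝓘(ℝ, E) g y) (hf : MDifferentiableAt 𝓘(ℝ, E) 𝓘(ℝ, E) f x)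
    (hy : f x = y) : mderiv E (fun z => g (f z)) x = mderiv E g y ∘L mderiv E f x := by
  subst hy
  exact mfderiv_comp x hg hf

theorem mdifferentiableAt_of_chart {f : M → N} {x : M} {y : N} (hy : f x = y)
    (hc : ContinuousAt f x)
    (hf : DifferentiableAt ℝ (fun z => chartAt E y (f ((chartAt E x).symm z))) (chartAt E x x)) :
    MDifferentiableAt 𝓘(ℝ, E) 𝓘(ℝ, E) f x := by
  subst hy
  rw [mdifferentiableAt_iff]
  refine ⟨hc, ?_⟩
  simpa [writtenInExtChartAt, Function.comp_def, differentiableWithinAt_univ] using hf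

omit [NormedSpace ℝ E] in
theorem chartAt_comp_symm_eventuallyEq (x : M) :
    (fun z => chartAt E x ((chartAt E x).symm z)) =ᶠ[𝓝 (chartAt E x x)] fun z => z :=
  (chartAt E x).eventually_right_inverse (mem_chart_target E x)

theorem mdifferentiableAt_chartAt_self (x : M) :
    MDifferentiableAt 𝓘(ℝ, E) 𝓘(ℝ, E) (chartAt E x) x :=
  mdifferentiableAt_of_chart rfl ((chartAt E x).continuousAt (mem_chart_source E x))
    (differentiableAt_id.congr_of_eventuallyEq (chartAt_comp_symm_eventuallyEq x))

theorem mderiv_chartAt_self (x : M) : mderiv E (chartAt E x) x = .id ℝ E := by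
  rw [mderiv_eq_fderiv (mdifferentiableAt_chartAt_self x) rfl]
  exact (chartAt_comp_symm_eventuallyEq x).fderiv_eq.trans fderiv_fun_id

theorem mderiv_eq_fderiv_of_target {f : E → M} {e : E} {x : M}
    (hf : MDifferentiableAt 𝓘(ℝ, E) 𝓘(ℝ, E) f e) (hx : f e = x) :
    mderiv E f e = fderiv ℝ (fun z => chartAt E x (f z)) e :=
  mderiv_eq_fderiv hf hx

theorem Form.inChart_eq (η : Form E M p) (x : M) (y : E) :
    η.inChart x y = ContinuousAlternatingMap.compContinuousLinearMap
      (η ((chartAt E x).symm y) : E [⋀^Fin p]→L[ℝ] ℝ) (mderiv E (chartAt E x).symm y) := rfl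

theorem Form.d_eq (η : Form E M p) (x : M) :
    (η.d x : E [⋀^Fin (p + 1)]→L[ℝ] ℝ) = extDeriv (η.inChart x) (chartAt E x x) := by
  have : (η.d x : E [⋀^Fin (p + 1)]→L[ℝ] ℝ) = (extDeriv (η.inChart x)
      (chartAt E x x)).compContinuousLinearMap (mderiv E (chartAt E x) x) := rfl
  rw [this, mderiv_chartAt_self]
  rfl

theorem contDiffAt_chart [IsManifold 𝓘(ℝ, E) ∞ M] [IsManifold 𝓘(ℝ, E) ∞ N] {f : M → N}
    {a : M} {b : N} {y : E} (hy : y ∈ (chartAt E a).target)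
    (hf : ContMDiffAt 𝓘(ℝ, E) 𝓘(ℝ, E) ∞ f ((chartAt E a).symm y))
    (hb : f ((chartAt E a).symm y) ∈ (chartAt E b).source) :
    ContDiffAt ℝ ∞ (fun z => chartAt E b (f ((chartAt E a).symm z))) y := by
  rw [← contMDiffAt_iff_contDiffAt]
  have h1 : ContMDiffAt 𝓘(ℝ, E) 𝓘(ℝ, E) ∞ (chartAt E a).symm y :=
    contMDiffOn_chart_symm.contMDiffAt ((chartAt E a).open_target.mem_nhds hy)
  have h2 : ContMDiffAt 𝓘(ℝ, E) 𝓘(ℝ, E) ∞ (chartAt E b) (f ((chartAt E a).symm y)) :=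
    contMDiffOn_chart.contMDiffAt ((chartAt E b).open_source.mem_nhds hb)
  exact h2.comp y (hf.comp y h1)

end Charts

/-! ### A Lie group in the chart at the identity -/

section LieGroupChart

variable {E : Type*} [NormedAddCommGroup E] [NormedSpace ℝ E]
  {G : Type*} [Group G] [TopologicalSpace G] [ChartedSpace E G]

variable (E G) in
/-- The identity element in the chart at the identity. -/
def chartOne : E := chartAt E (1 : G) 1

variable (E G) in
/-- The multiplication in the chart at the identity. -/
def chartMul (y z : E) : E :=
  chartAt E (1 : G) ((chartAt E (1 : G)).symm y * (chartAt E (1 : G)).symm z)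

variable (E G) in
/-- The left division `(y, z) ↦ y⁻¹ z` in the chart at the identity. -/
def chartLeftDiv (y z : E) : E :=
  chartAt E (1 : G) (((chartAt E (1 : G)).symm y)⁻¹ * (chartAt E (1 : G)).symm z)

variable (E G) in
/-- The Maurer–Cartan form in the chart at the identity: the differential at `y` of the left
translation by `y⁻¹`. -/
def maurerCartan (y : E) : E →L[ℝ] E := fderiv ℝ (chartLeftDiv E G y) y

variable (E G) in
/-- The left-invariant frame in the chart at the identity. -/
def leftFrame (y : E) : E →L[ℝ] E := fderiv ℝ (chartMul E G y) (chartOne E G)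

variable (E G) in
/-- The right-invariant frame in the chart at the identity. -/
def rightFrame (y : E) : E →L[ℝ] E := fderiv ℝ (fun z => chartMul E G z y) (chartOne E G)

omit [NormedSpace ℝ E] in
theorem chartOne_mem_target : chartOne E G ∈ (chartAt E (1 : G)).target := mem_chart_target E 1

omit [NormedSpace ℝ E] in
theorem chart_symm_chartOne : (chartAt E (1 : G)).symm (chartOne E G) = 1 :=
  (chartAt E (1 : G)).left_inv (mem_chart_source E 1)

omit [NormedSpace ℝ E] in
theorem eventually_chart_right_inv :
    ∀ᶠ y in 𝓝 (chartOne E G), chartAt E (1 : G) ((chartAt E (1 : G)).symm y) = y :=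
  chartAt_comp_symm_eventuallyEq (1 : G)

omit [NormedSpace ℝ E] in
theorem chartLeftDiv_one :
    chartLeftDiv E G (chartOne E G) =ᶠ[𝓝 (chartOne E G)] fun z => z := by
  filter_upwards [eventually_chart_right_inv (E := E) (G := G)] with z hz
  rw [chartLeftDiv, chart_symm_chartOne, inv_one, one_mul, hz]

omit [NormedSpace ℝ E] in
theorem chartMul_one_left : chartMul E G (chartOne E G) =ᶠ[𝓝 (chartOne E G)] fun z => z := by
  filter_upwards [eventually_chart_right_inv (E := E) (G := G)] with z hz
  rw [chartMul, chart_symm_chartOne, one_mul, hz]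

omit [NormedSpace ℝ E] in
theorem chartMul_one_right :
    (fun y => chartMul E G y (chartOne E G)) =ᶠ[𝓝 (chartOne E G)] fun z => z := by
  filter_upwards [eventually_chart_right_inv (E := E) (G := G)] with z hz
  rw [chartMul, chart_symm_chartOne, mul_one, hz]

theorem maurerCartan_one : maurerCartan E G (chartOne E G) = .id ℝ E := by
  rw [maurerCartan, chartLeftDiv_one.fderiv_eq]
  exact fderiv_fun_id

theorem leftFrame_one : leftFrame E G (chartOne E G) = .id ℝ E := by
  rw [leftFrame, chartMul_one_left.fderiv_eq]
  exact fderiv_fun_id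

theorem rightFrame_one : rightFrame E G (chartOne E G) = .id ℝ E := by
  rw [rightFrame, chartMul_one_right.fderiv_eq]
  exact fderiv_fun_id

variable [LieGroup 𝓘(ℝ, E) ∞ G]

theorem two_le_infty : (2 : ℕ∞ω) ≤ ∞ :=
  WithTop.coe_le_coe.2 (le_top : (2 : ℕ∞) ≤ ⊤)

theorem contDiffAt_chartMul :
    ContDiffAt ℝ ∞ (fun p : E × E => chartMul E G p.1 p.2) (chartOne E G, chartOne E G) := by
  rw [← contMDiffAt_iff_contDiffAt]
  have h1 : ContMDiffAt 𝓘(ℝ, E) 𝓘(ℝ, E) ∞ (chartAt E (1 : G)).symm (chartOne E G) :=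
    contMDiffOn_chart_symm.contMDiffAt
      ((chartAt E (1 : G)).open_target.mem_nhds chartOne_mem_target)
  have hf : ContMDiffAt 𝓘(ℝ, E × E) 𝓘(ℝ, E) ∞ (fun p : E × E => (chartAt E (1 : G)).symm p.1)
      (chartOne E G, chartOne E G) := h1.comp (chartOne E G, chartOne E G)
        (contMDiffAt_iff_contDiffAt.2 contDiffAt_fst)
  have hs : ContMDiffAt 𝓘(ℝ, E × E) 𝓘(ℝ, E) ∞ (fun p : E × E => (chartAt E (1 : G)).symm p.2)
      (chartOne E G, chartOne E G) := h1.comp (chartOne E G, chartOne E G)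
        (contMDiffAt_iff_contDiffAt.2 contDiffAt_snd)
  have h2 : ContMDiffAt 𝓘(ℝ, E) 𝓘(ℝ, E) ∞ (chartAt E (1 : G))
      ((chartAt E (1 : G)).symm (chartOne E G) * (chartAt E (1 : G)).symm (chartOne E G)) := by
    rw [chart_symm_chartOne, one_mul]
    exact contMDiffOn_chart.contMDiffAt
      ((chartAt E (1 : G)).open_source.mem_nhds (mem_chart_source E 1))
  exact h2.comp (chartOne E G, chartOne E G) (hf.mul hs)

theorem contDiffAt_chartLeftDiv :
    ContDiffAt ℝ ∞ (fun p : E × E => chartLeftDiv E G p.1 p.2) (chartOne E G, chartOne E G) := by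
  rw [← contMDiffAt_iff_contDiffAt]
  have h1 : ContMDiffAt 𝓘(ℝ, E) 𝓘(ℝ, E) ∞ (chartAt E (1 : G)).symm (chartOne E G) :=
    contMDiffOn_chart_symm.contMDiffAt
      ((chartAt E (1 : G)).open_target.mem_nhds chartOne_mem_target)
  have hf : ContMDiffAt 𝓘(ℝ, E × E) 𝓘(ℝ, E) ∞ (fun p : E × E => (chartAt E (1 : G)).symm p.1)
      (chartOne E G, chartOne E G) := h1.comp (chartOne E G, chartOne E G)
        (contMDiffAt_iff_contDiffAt.2 contDiffAt_fst)
  have hs : ContMDiffAt 𝓘(ℝ, E × E) 𝓘(ℝ, E) ∞ (fun p : E × E => (chartAt E (1 : G)).symm p.2)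
      (chartOne E G, chartOne E G) := h1.comp (chartOne E G, chartOne E G)
        (contMDiffAt_iff_contDiffAt.2 contDiffAt_snd)
  have h2 : ContMDiffAt 𝓘(ℝ, E) 𝓘(ℝ, E) ∞ (chartAt E (1 : G))
      (((chartAt E (1 : G)).symm (chartOne E G))⁻¹ * (chartAt E (1 : G)).symm (chartOne E G)) := by
    rw [chart_symm_chartOne, inv_one, one_mul]
    exact contMDiffOn_chart.contMDiffAt
      ((chartAt E (1 : G)).open_source.mem_nhds (mem_chart_source E 1))
  exact h2.comp (chartOne E G, chartOne E G) (hf.inv.mul hs)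

/-- The differential in the second variable, in terms of the differential on the product. -/
theorem fderiv_snd_eq {F : E → E → E} {y z : E}
    (h : DifferentiableAt ℝ (fun p : E × E => F p.1 p.2) (y, z)) :
    fderiv ℝ (F y) z = fderiv ℝ (fun p : E × E => F p.1 p.2) (y, z) ∘L .inr ℝ E E :=
  (h.hasFDerivAt.comp z (hasFDerivAt_prodMk_right y z)).fderiv

theorem fderiv_fst_eq {F : E → E → E} {y z : E}
    (h : DifferentiableAt ℝ (fun p : E × E => F p.1 p.2) (y, z)) :
    fderiv ℝ (fun x => F x z) y = fderiv ℝ (fun p : E × E => F p.1 p.2) (y, z) ∘L .inl ℝ E E :=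
  (HasFDerivAt.comp (f := fun x => (x, z)) y h.hasFDerivAt (hasFDerivAt_prodMk_left y z)).fderiv

theorem eventually_differentiableAt {F : E → E → E} {e : E}
    (h : ContDiffAt ℝ ∞ (fun p : E × E => F p.1 p.2) (e, e)) :
    ∀ᶠ p in 𝓝 ((e, e) : E × E), DifferentiableAt ℝ (fun p : E × E => F p.1 p.2) p := by
  filter_upwards [(h.of_le (show (1 : ℕ∞ω) ≤ ∞ by exact_mod_cast le_top)).eventually (by simp)]
    with p hp using hp.differentiableAt (by simp)

theorem differentiableAt_maurerCartan :
    DifferentiableAt ℝ (maurerCartan E G) (chartOne E G) := by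
  set e := chartOne E G
  have h := contDiffAt_chartLeftDiv (E := E) (G := G)
  have h1 : DifferentiableAt ℝ (fderiv ℝ fun p : E × E => chartLeftDiv E G p.1 p.2) (e, e) :=
    (h.fderiv_right (m := 1) (one_add_one_eq_two.trans_le two_le_infty)).differentiableAt (by simp)
  have h2 : DifferentiableAt ℝ (fun y : E => (fderiv ℝ (fun p : E × E =>
      chartLeftDiv E G p.1 p.2) (y, y)) ∘L ContinuousLinearMap.inr ℝ E E) e :=
    (DifferentiableAt.comp (f := fun y : E => (y, y)) e h1
      (differentiableAt_id.prodMk differentiableAt_id)).clm_comp (differentiableAt_const _)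
  refine h2.congr_of_eventuallyEq ?_
  have h3 : Tendsto (fun y : E => (y, y)) (𝓝 e) (𝓝 (e, e)) :=
    (continuous_id.prodMk continuous_id).continuousAt
  filter_upwards [h3.eventually (eventually_differentiableAt h)] with y hy using fderiv_snd_eq hy

/-- The frames are given by partial derivatives of the product, and their derivatives by mixed
second derivatives, whose symmetry relates the left and the right frame. -/
theorem exists_hasFDerivAt_frames : ∃ B : E →L[ℝ] E →L[ℝ] E,
    HasFDerivAt (leftFrame E G) B (chartOne E G) ∧
      HasFDerivAt (rightFrame E G) B.flip (chartOne E G) := by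
  set e := chartOne E G
  have h := contDiffAt_chartMul (E := E) (G := G)
  set F : E × E → E := fun p => chartMul E G p.1 p.2
  have h1 : HasFDerivAt (fderiv ℝ F) (fderiv ℝ (fderiv ℝ F) (e, e)) (e, e) :=
    ((h.fderiv_right (m := 1) (one_add_one_eq_two.trans_le two_le_infty)).differentiableAt
      (by simp)).hasFDerivAt
  have hsymm : IsSymmSndFDerivAt ℝ F (e, e) := h.isSymmSndFDerivAt (by simpa using two_le_infty)
  have hL := (HasFDerivAt.comp (f := fun y => (y, e)) e h1
    (hasFDerivAt_prodMk_left e e)).clm_comp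
    (hasFDerivAt_const (ContinuousLinearMap.inr ℝ E E) e)
  have hR := (HasFDerivAt.comp (f := fun y => (e, y)) e h1
    (hasFDerivAt_prodMk_right e e)).clm_comp
    (hasFDerivAt_const (ContinuousLinearMap.inl ℝ E E) e)
  have hLF : HasFDerivAt (leftFrame E G) _ e := hL.congr_of_eventuallyEq <| by
    have h3 : Tendsto (fun y : E => (y, e)) (𝓝 e) (𝓝 (e, e)) :=
      (continuous_id.prodMk continuous_const).continuousAt
    filter_upwards [h3.eventually (eventually_differentiableAt h)] with y hy using fderiv_snd_eq hy
  have hRF : HasFDerivAt (rightFrame E G) _ e := hR.congr_of_eventuallyEq <| by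
    have h3 : Tendsto (fun y : E => (e, y)) (𝓝 e) (𝓝 (e, e)) :=
      (continuous_const.prodMk continuous_id).continuousAt
    filter_upwards [h3.eventually (eventually_differentiableAt h)] with y hy using fderiv_fst_eq hy
  refine ⟨_, hLF, hRF.congr_fderiv ?_⟩
  ext v w
  simpa using hsymm (0, v) (w, 0)

/-- The Maurer–Cartan form is dual to the left-invariant frame. -/
theorem maurerCartan_comp_leftFrame [IsTopologicalGroup G] : ∀ᶠ y in 𝓝 (chartOne E G),
    maurerCartan E G y ∘L leftFrame E G y = .id ℝ E := by
  set e := chartOne E G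
  have hm := contDiffAt_chartMul (E := E) (G := G)
  have hd := contDiffAt_chartLeftDiv (E := E) (G := G)
  have h2 : Tendsto (fun y : E => (y, y)) (𝓝 e) (𝓝 (e, e)) :=
    (continuous_id.prodMk continuous_id).continuousAt
  have h3 : Tendsto (fun y : E => (y, e)) (𝓝 e) (𝓝 (e, e)) :=
    (continuous_id.prodMk continuous_const).continuousAt
  filter_upwards [h3.eventually (eventually_differentiableAt hm),
    h2.eventually (eventually_differentiableAt hd),
    eventually_chart_right_inv (E := E) (G := G),
    (chartAt E (1 : G)).open_target.mem_nhds chartOne_mem_target] with y hy1 hy2 hy3 hy4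
  have hye : chartMul E G y e = y := by
    rw [chartMul, chart_symm_chartOne, mul_one, hy3]
  have hm1 : DifferentiableAt ℝ (chartMul E G y) e :=
    (hy1.hasFDerivAt.comp e (hasFDerivAt_prodMk_right y e)).differentiableAt
  have hd1 : DifferentiableAt ℝ (chartLeftDiv E G y) (chartMul E G y e) := by
    rw [hye]
    exact (hy2.hasFDerivAt.comp y (hasFDerivAt_prodMk_right y y)).differentiableAt
  have hc := fderiv_comp e hd1 hm1
  rw [hye] at hc
  rw [maurerCartan, leftFrame, ← hc]
  have hcont : ContinuousAt (fun z => (chartAt E (1 : G)).symm y * (chartAt E (1 : G)).symm z) e :=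
    continuousAt_const.mul ((chartAt E (1 : G)).continuousAt_symm chartOne_mem_target)
  have hsrc : ∀ᶠ z in 𝓝 e, (chartAt E (1 : G)).symm y * (chartAt E (1 : G)).symm z ∈
      (chartAt E (1 : G)).source := by
    refine hcont.eventually_mem ((chartAt E (1 : G)).open_source.mem_nhds ?_)
    rw [chart_symm_chartOne, mul_one]
    exact (chartAt E (1 : G)).map_target hy4
  have : chartLeftDiv E G y ∘ chartMul E G y =ᶠ[𝓝 e] fun z => z := by
    filter_upwards [hsrc, eventually_chart_right_inv (E := E) (G := G)] with z hz1 hz2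
    rw [Function.comp_apply, chartLeftDiv, chartMul, (chartAt E (1 : G)).left_inv hz1,
      inv_mul_cancel_left, hz2]
  rw [this.fderiv_eq]
  exact fderiv_fun_id

end LieGroupChart

/-! ### Nilpotent Lie groups are unimodular -/

section Unimodular

theorem det_one_add_of_isNilpotent {V : Type*} [AddCommGroup V] [Module ℝ V]
    [FiniteDimensional ℝ V] {N : V →ₗ[ℝ] V} (hN : IsNilpotent N) : LinearMap.det (1 + N) = 1 := by
  have h := LinearMap.eval_charpoly (-N) 1
  rw [(LinearMap.isNilpotent_iff_charpoly (-N)).1 hN.neg, map_one, sub_neg_eq_add] at h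
  rw [← h]
  simp

/-- Iterating the commutator with a fixed element goes down the lower central series. -/
theorem iterate_commutator_mem_lowerCentralSeries {G : Type*} [Group G] (b x : G) (N : ℕ) :
    (fun x => b * x * b⁻¹ * x⁻¹)^[N] x ∈ (⊤ : Subgroup G).lowerCentralSeries N := by
  induction N with
  | zero => simp
  | succ N ih =>
    rw [Function.iterate_succ_apply', Subgroup.lowerCentralSeries_succ, Subgroup.commutator_comm]
    exact Subgroup.commutator_mem_commutator (Subgroup.mem_top b) ih

variable {E : Type*} [NormedAddCommGroup E] [NormedSpace ℝ E]
  {G : Type*} [Group G] [TopologicalSpace G] [IsTopologicalGroup G] [ChartedSpace E G]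
  [LieGroup 𝓘(ℝ, E) ∞ G]

variable (E) in
/-- The adjoint action of `b` on the tangent space at the identity, in the chart. -/
def chartAd (b : G) : E →L[ℝ] E :=
  fderiv ℝ (fun z => chartAt E (1 : G) (b * (chartAt E (1 : G)).symm z * b⁻¹)) (chartOne E G)

omit [IsTopologicalGroup G] in
theorem contDiffAt_chartOne {f : G → G} (hf : ContMDiff 𝓘(ℝ, E) 𝓘(ℝ, E) ∞ f) (h1 : f 1 = 1) :
    ContDiffAt ℝ ∞ (fun z => chartAt E (1 : G) (f ((chartAt E (1 : G)).symm z)))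
      (chartOne E G) := by
  refine contDiffAt_chart chartOne_mem_target hf.contMDiffAt ?_
  rw [chart_symm_chartOne, h1]
  exact mem_chart_source E 1

omit [NormedSpace ℝ E] [LieGroup 𝓘(ℝ, E) ∞ G] [IsTopologicalGroup G] in
theorem eventually_mem_source {f : G → G} (hf : Continuous f) (h1 : f 1 = 1) :
    ∀ᶠ z in 𝓝 (chartOne E G), f ((chartAt E (1 : G)).symm z) ∈ (chartAt E (1 : G)).source := by
  have : ContinuousAt (fun z => f ((chartAt E (1 : G)).symm z)) (chartOne E G) :=
    hf.continuousAt.comp ((chartAt E (1 : G)).continuousAt_symm chartOne_mem_target)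
  refine this.eventually_mem ((chartAt E (1 : G)).open_source.mem_nhds ?_)
  rw [chart_symm_chartOne, h1]
  exact mem_chart_source E 1

omit [IsTopologicalGroup G] in
theorem contMDiff_conj (b : G) : ContMDiff 𝓘(ℝ, E) 𝓘(ℝ, E) ∞ fun x : G => b * x * b⁻¹ :=
  (contMDiff_const.mul contMDiff_id).mul contMDiff_const

/-- The map `x ↦ b x b⁻¹ x⁻¹` fixes `1`, has differential `Ad b - 1` there, and in a nilpotent group
some iterate of it is constant. -/
theorem exists_nilpotent_chartAd [Group.IsNilpotent G] (b : G) :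
    ∃ N : E →L[ℝ] E, IsNilpotent N ∧ chartAd E b = .id ℝ E + N := by
  set e := chartOne E G
  let c : G → G := fun x => b * x * b⁻¹ * x⁻¹
  have hc1 : c 1 = 1 := by simp [c]
  have hcc : Continuous c := by fun_prop
  have hcs : ContMDiff 𝓘(ℝ, E) 𝓘(ℝ, E) ∞ c := (contMDiff_conj b).mul contMDiff_id.inv
  let K : E → E := fun z => chartAt E (1 : G) (c ((chartAt E (1 : G)).symm z))
  have hK : HasFDerivAt K (fderiv ℝ K e) e :=
    ((contDiffAt_chartOne hcs hc1).differentiableAt (by simp)).hasFDerivAt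
  have hKe : K e = e := by
    change chartAt E (1 : G) (c ((chartAt E (1 : G)).symm (chartOne E G))) = _
    rw [chart_symm_chartOne, hc1]
    rfl
  refine ⟨fderiv ℝ K e, ?_, ?_⟩
  · obtain ⟨N, hN⟩ := Subgroup.nilpotent_iff_lowerCentralSeries.1 ‹Group.IsNilpotent G›
    refine ⟨N, ?_⟩
    have hiter (i : ℕ) : ∀ᶠ z in 𝓝 e,
        K^[i] z = chartAt E (1 : G) (c^[i] ((chartAt E (1 : G)).symm z)) := by
      induction i with
      | zero =>
        filter_upwards [eventually_chart_right_inv (E := E) (G := G)] with z hz using hz.symm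
      | succ i ih =>
        filter_upwards [ih, eventually_mem_source (E := E) (hcc.iterate i)
          (Function.iterate_fixed hc1 i)] with z hz1 hz2
        rw [Function.iterate_succ_apply', Function.iterate_succ_apply', hz1]
        change chartAt E (1 : G) (c ((chartAt E (1 : G)).symm (chartAt E (1 : G) _))) = _
        rw [(chartAt E (1 : G)).left_inv hz2]
    have hconst : K^[N] =ᶠ[𝓝 e] fun _ => chartAt E (1 : G) 1 := by
      filter_upwards [hiter N] with z hz
      rw [hz]
      have := iterate_commutator_mem_lowerCentralSeries b ((chartAt E (1 : G)).symm z) N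
      rw [hN, Subgroup.mem_bot] at this
      rw [this]
    exact (hK.iterate hKe N).unique ((hasFDerivAt_const _ e).congr_of_eventuallyEq hconst)
  · have hm := contDiffAt_chartMul (E := E) (G := G)
    have hmd := (hm.differentiableAt (by simp))
    have hconj : (fun z => chartAt E (1 : G) (b * (chartAt E (1 : G)).symm z * b⁻¹)) =ᶠ[𝓝 e]
        fun z => chartMul E G (K z) z := by
      filter_upwards [eventually_mem_source (E := E) hcc hc1] with z hz
      rw [chartMul, (chartAt E (1 : G)).left_inv hz]
      simp [c]
    have hm0 : HasFDerivAt (fun p : E × E => chartMul E G p.1 p.2)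
        (fderiv ℝ (fun p : E × E => chartMul E G p.1 p.2) (e, e)) (K e, e) := by
      rw [hKe]
      exact hmd.hasFDerivAt
    have hcomp : HasFDerivAt (fun z => chartMul E G (K z) z) _ e :=
      HasFDerivAt.comp (f := fun z => (K z, z)) e hm0 (hK.prodMk (hasFDerivAt_id e))
    rw [chartAd, hconj.fderiv_eq, hcomp.fderiv]
    have hl := fderiv_snd_eq hmd
    have hr := fderiv_fst_eq hmd
    have hl' : fderiv ℝ (chartMul E G (chartOne E G)) (chartOne E G) = .id ℝ E := leftFrame_one
    have hr' : fderiv ℝ (fun z => chartMul E G z (chartOne E G)) (chartOne E G) = .id ℝ E :=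
      rightFrame_one
    rw [hl'] at hl
    rw [hr'] at hr
    ext v
    have h1 := DFunLike.congr_fun hl v
    have h2 := DFunLike.congr_fun hr (fderiv ℝ K e v)
    simp only [ContinuousLinearMap.comp_apply, ContinuousLinearMap.inl_apply,
      ContinuousLinearMap.inr_apply, ContinuousLinearMap.id_apply] at h1 h2
    simp only [ContinuousLinearMap.comp_apply, ContinuousLinearMap.prod_apply, add_apply,
      ContinuousLinearMap.id_apply]
    rw [show (fderiv ℝ K e v, v) = ((fderiv ℝ K e v, 0) : E × E) + (0, v) by simp, map_add]
    exact (congrArg₂ (· + ·) h2.symm h1.symm).trans (add_comm _ _)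

variable [FiniteDimensional ℝ E]

theorem det_chartAd [Group.IsNilpotent G] (b : G) :
    LinearMap.det (chartAd E b : E →ₗ[ℝ] E) = 1 := by
  obtain ⟨N, ⟨k, hk⟩, h⟩ := exists_nilpotent_chartAd (E := E) b
  rw [h]
  refine det_one_add_of_isNilpotent (N := (N : E →ₗ[ℝ] E)) ⟨k, ?_⟩
  have := congrArg (fun f : E →L[ℝ] E => (f : E →ₗ[ℝ] E)) hk
  rw [← ContinuousLinearMap.toLinearMap_pow]
  exact this

/-- The left-invariant frame at `b` is the right-invariant one composed with `Ad b`. -/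
theorem det_leftFrame_eq_det_rightFrame [Group.IsNilpotent G] : ∀ᶠ y in 𝓝 (chartOne E G),
    LinearMap.det (leftFrame E G y : E →ₗ[ℝ] E) = LinearMap.det (rightFrame E G y : E →ₗ[ℝ] E) := by
  set e := chartOne E G
  have hm := contDiffAt_chartMul (E := E) (G := G)
  have h3 : Tendsto (fun y : E => (e, y)) (𝓝 e) (𝓝 (e, e)) :=
    (continuous_const.prodMk continuous_id).continuousAt
  filter_upwards [h3.eventually (eventually_differentiableAt hm)] with y hy1
  set b := (chartAt E (1 : G)).symm y with hb
  let κ : E → E := fun z => chartAt E (1 : G) (b * (chartAt E (1 : G)).symm z * b⁻¹)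
  have hκe : κ e = e := by
    change chartAt E (1 : G) (b * (chartAt E (1 : G)).symm (chartOne E G) * b⁻¹) = _
    rw [chart_symm_chartOne, mul_one, mul_inv_cancel]
    rfl
  have hκ : DifferentiableAt ℝ κ e :=
    (contDiffAt_chartOne (contMDiff_conj b) (by simp)).differentiableAt (by simp)
  have hfac : chartMul E G y =ᶠ[𝓝 e] (fun z => chartMul E G z y) ∘ κ := by
    filter_upwards [eventually_mem_source (E := E) (f := fun x => b * x * b⁻¹) (by fun_prop)
      (by simp)] with z hz
    rw [Function.comp_apply, chartMul, chartMul, (chartAt E (1 : G)).left_inv hz, ← hb,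
      inv_mul_cancel_right]
  have hr : DifferentiableAt ℝ (fun z => chartMul E G z y) (κ e) := by
    rw [hκe]
    exact (HasFDerivAt.comp (f := fun x => (x, y)) e hy1.hasFDerivAt
      (hasFDerivAt_prodMk_left e y)).differentiableAt
  have key : leftFrame E G y = rightFrame E G y ∘L chartAd E b := by
    rw [leftFrame, hfac.fderiv_eq, fderiv_comp _ hr hκ, hκe]
    rfl
  rw [key, ContinuousLinearMap.toLinearMap_comp, LinearMap.det_comp, det_chartAd, mul_one]

/-- On a nilpotent Lie group, the differential of left-invariant forms vanishes in codegree one. -/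
theorem frameDeriv_maurerCartan_eq_zero [Group.IsNilpotent G] {p : ℕ} (hp : finrank ℝ E = p + 1)
    (a : E [⋀^Fin p]→L[ℝ] ℝ) : frameDeriv (maurerCartan E G) (chartOne E G) a = 0 := by
  obtain ⟨B, hL, hR⟩ := exists_hasFDerivAt_frames (E := E) (G := G)
  obtain ⟨D₁, hD₁, hD₁'⟩ := hasFDerivAt_det hL leftFrame_one
  obtain ⟨D₂, hD₂, hD₂'⟩ := hasFDerivAt_det hR rightFrame_one
  have hD : D₁ = D₂ :=
    hD₁.unique (hD₂.congr_of_eventuallyEq det_leftFrame_eq_det_rightFrame)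
  have hM := (differentiableAt_maurerCartan (E := E) (G := G)).hasFDerivAt
  have hMB : fderiv ℝ (maurerCartan E G) (chartOne E G) = -B := by
    have h := (hM.clm_comp hL).unique
      ((hasFDerivAt_const _ _).congr_of_eventuallyEq maurerCartan_comp_leftFrame)
    ext v w
    have h1 := DFunLike.congr_fun (DFunLike.congr_fun h v) w
    simp only [maurerCartan_one, leftFrame_one] at h1
    refine eq_neg_of_add_eq_zero_right ?_
    simpa using h1
  refine frameDeriv_eq_zero hM maurerCartan_one (fun X => ?_) hp a
  have h1 : LinearMap.trace ℝ E (B X : E →ₗ[ℝ] E) = LinearMap.trace ℝ E (B.flip X : E →ₗ[ℝ] E) := by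
    rw [← hD₁', ← hD₂', hD]
  have h2 : ((-B) X : E →L[ℝ] E) = -(B X) := rfl
  have h3 : ((-B).flip X : E →L[ℝ] E) = -(B.flip X) := rfl
  rw [hMB, h2, h3, ContinuousLinearMap.toLinearMap_neg, ContinuousLinearMap.toLinearMap_neg,
    map_neg, map_neg, h1]

end Unimodular

/-! ### Left-invariant forms on a Lie group -/

section LeftInvariantForms

variable {E : Type*} [NormedAddCommGroup E] [NormedSpace ℝ E]
  {G : Type*} [Group G] [TopologicalSpace G] [ChartedSpace E G] {p : ℕ}

variable (G) in
/-- The left-invariant form on `G` with value `α` at the identity. -/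
def leftForm (α : E [⋀^Fin p]→L[ℝ] ℝ) : Form E G p := fun b =>
  α.compContinuousLinearMap (mderiv E (fun z => b⁻¹ * z) b)

variable [LieGroup 𝓘(ℝ, E) ∞ G]

theorem mdifferentiableAt_mul_left (a b : G) :
    MDifferentiableAt 𝓘(ℝ, E) 𝓘(ℝ, E) (fun z => a * z) b :=
  (contMDiff_mul_left (I := 𝓘(ℝ, E)) (n := ∞)).mdifferentiableAt (by simp)

theorem mdifferentiableAt_chart_symm {a : G} {y : E}
    (hy : y ∈ (chartAt E a).target) :
    MDifferentiableAt 𝓘(ℝ, E) 𝓘(ℝ, E) (chartAt E a).symm y :=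
  ((contMDiffOn_chart_symm (n := ∞)).contMDiffAt
    ((chartAt E a).open_target.mem_nhds hy)).mdifferentiableAt (by simp)

theorem mderiv_mul_left_inv_comp (b : G) :
    mderiv E (fun z => b⁻¹ * z) b ∘L mderiv E (fun z => b * z) 1 = .id ℝ E := by
  rw [← mderiv_comp (mdifferentiableAt_mul_left _ _) (mdifferentiableAt_mul_left _ _) (mul_one b)]
  simp only [inv_mul_cancel_left]
  exact mfderiv_id

theorem mderiv_mul_left_comp_inv (b : G) :
    mderiv E (fun z => b * z) 1 ∘L mderiv E (fun z => b⁻¹ * z) b = .id ℝ E := by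
  rw [← mderiv_comp (mdifferentiableAt_mul_left _ _) (mdifferentiableAt_mul_left _ _)
    (inv_mul_cancel b)]
  simp only [mul_inv_cancel_left]
  exact mfderiv_id

theorem inChart_leftForm (α : E [⋀^Fin p]→L[ℝ] ℝ) (a : G) {y : E}
    (hy : y ∈ (chartAt E a).target) :
    (leftForm G α).inChart a y = α.compContinuousLinearMap (fderiv ℝ (fun z =>
      chartAt E (1 : G) (((chartAt E a).symm y)⁻¹ * (chartAt E a).symm z)) y) := by
  have h1 := mdifferentiableAt_mul_left (E := E) ((chartAt E a).symm y)⁻¹ ((chartAt E a).symm y)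
  have h2 := mdifferentiableAt_chart_symm hy
  have h3 : MDifferentiableAt 𝓘(ℝ, E) 𝓘(ℝ, E)
      (fun z => ((chartAt E a).symm y)⁻¹ * (chartAt E a).symm z) y := h1.comp y h2
  rw [← mderiv_eq_fderiv_of_target h3 (inv_mul_cancel _), mderiv_comp h1 h2 rfl]
  rfl

/-- The exterior derivative preserves left-invariance: the form in the chart at `a` is the pullback,
by the left translation by `a⁻¹`, of the form in the chart at `1`. -/
theorem d_leftForm [ContinuousMul G] (α : E [⋀^Fin p]→L[ℝ] ℝ) :
    (leftForm G α).d = leftForm G (frameDeriv (maurerCartan E G) (chartOne E G) α) := by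
  funext a
  let F : E → E := fun z => chartAt E (1 : G) (a⁻¹ * (chartAt E a).symm z)
  let e' : E := chartAt E a a
  have hsa : (chartAt E a).symm e' = a := (chartAt E a).left_inv (mem_chart_source E a)
  have hFe : F e' = chartOne E G := by
    change chartAt E (1 : G) (a⁻¹ * (chartAt E a).symm e') = chartAt E (1 : G) 1
    rw [hsa, inv_mul_cancel]
  have hmul (c : G) : ContMDiff 𝓘(ℝ, E) 𝓘(ℝ, E) ∞ fun z : G => c * z := contMDiff_mul_left
  have hFs {y : E} (hy : y ∈ (chartAt E a).target)
      (hy' : a⁻¹ * (chartAt E a).symm y ∈ (chartAt E (1 : G)).source) : ContDiffAt ℝ ∞ F y :=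
    contDiffAt_chart hy (hmul a⁻¹).contMDiffAt hy'
  have htgt : ∀ᶠ y in 𝓝 e', y ∈ (chartAt E a).target :=
    (chartAt E a).open_target.mem_nhds (mem_chart_target E a)
  have hsrc : ∀ᶠ y in 𝓝 e', a⁻¹ * (chartAt E a).symm y ∈ (chartAt E (1 : G)).source := by
    have : ContinuousAt (fun y => a⁻¹ * (chartAt E a).symm y) e' :=
      continuousAt_const.mul ((chartAt E a).continuousAt_symm (mem_chart_target E a))
    refine this.eventually_mem ((chartAt E (1 : G)).open_source.mem_nhds ?_)
    rw [hsa, inv_mul_cancel]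
    exact mem_chart_source E 1
  have hpull : (leftForm G α).inChart a =ᶠ[𝓝 e'] fun y =>
      (α.compContinuousLinearMap (maurerCartan E G (F y))).compContinuousLinearMap
        (fderiv ℝ F y) := by
    filter_upwards [htgt, hsrc, hsrc.eventually_nhds] with y hy hy' hy''
    rw [inChart_leftForm α a hy]
    have hFy : (chartAt E (1 : G)).symm (F y) = a⁻¹ * (chartAt E a).symm y :=
      (chartAt E (1 : G)).left_inv hy'
    have hFt : F y ∈ (chartAt E (1 : G)).target := (chartAt E (1 : G)).map_source hy'
    have hfac : (fun z => chartAt E (1 : G) (((chartAt E a).symm y)⁻¹ * (chartAt E a).symm z))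
        =ᶠ[𝓝 y] chartLeftDiv E G (F y) ∘ F := by
      filter_upwards [hy''] with z hz
      rw [Function.comp_apply, chartLeftDiv, hFy]
      change _ = chartAt E (1 : G) (_ * (chartAt E (1 : G)).symm (chartAt E (1 : G) _))
      rw [(chartAt E (1 : G)).left_inv hz]
      group
    have hdiv : DifferentiableAt ℝ (chartLeftDiv E G (F y)) (F y) := by
      refine (contDiffAt_chart hFt (hmul _).contMDiffAt ?_).differentiableAt (by simp)
      rw [inv_mul_cancel]
      exact mem_chart_source E 1
    rw [hfac.fderiv_eq, fderiv_comp y hdiv ((hFs hy hy').differentiableAt (by simp))]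
    rfl
  have hF : ContDiffAt ℝ ∞ F e' := hFs htgt.self_of_nhds hsrc.self_of_nhds
  have hω : DifferentiableAt ℝ (fun y => α.compContinuousLinearMap (maurerCartan E G y))
      (F e') := by
    rw [hFe]
    exact (hasFDerivAt_frame differentiableAt_maurerCartan.hasFDerivAt
      maurerCartan_one α).differentiableAt
  have hd := extDeriv_pullback hω hF (by simpa using two_le_infty)
  have hFd : fderiv ℝ F e' = mderiv E (fun z => a⁻¹ * z) a :=
    (mderiv_eq_fderiv (mdifferentiableAt_mul_left _ _) (inv_mul_cancel a)).symm
  refine (Form.d_eq _ a).trans (hpull.extDeriv_eq.trans (hd.trans ?_))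
  rw [hFd, hFe]
  rfl

end LeftInvariantForms

/-! ### The quotient by a discrete subgroup -/

section Quotient

variable {E : Type*} [NormedAddCommGroup E] [NormedSpace ℝ E]
  {G : Type*} [Group G] [TopologicalSpace G] [IsTopologicalGroup G] [T2Space G]
  [LocallyCompactSpace G] [ChartedSpace E G] (Γ : Subgroup G) [DiscreteTopology Γ] {p q : ℕ}

theorem isLocalHomeomorph_proj : IsLocalHomeomorph (proj Γ) :=
  isQuotientCoveringMap_quotientMk_of_properlyDiscontinuousSMul.isCoveringMap.isLocalHomeomorph

omit [TopologicalSpace G] [IsTopologicalGroup G] [T2Space G] [LocallyCompactSpace G]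
  [DiscreteTopology Γ] in
theorem proj_surjective : Function.Surjective (proj Γ) := Quotient.mk_surjective

/-- The representative of a point of `Γ \ G` on which the chart at this point is based. -/
def rep (x : LeftQuotient Γ) : G := (proj_surjective Γ).hasRightInverse.choose x

omit [TopologicalSpace G] [IsTopologicalGroup G] [T2Space G] [LocallyCompactSpace G]
  [DiscreteTopology Γ] in
theorem proj_rep (x : LeftQuotient Γ) : proj Γ (rep Γ x) = x :=
  (proj_surjective Γ).hasRightInverse.choose_spec x

omit [NormedSpace ℝ E] in
theorem chartAt_quotient (x : LeftQuotient Γ) : chartAt E x =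
    ((isLocalHomeomorph_proj Γ).localInverseAt (rep Γ x)).trans (chartAt E (rep Γ x)) := rfl

omit [NormedSpace ℝ E] in
theorem chartAt_quotient_symm (x : LeftQuotient Γ) (y : E) :
    (chartAt E x).symm y = proj Γ ((chartAt E (rep Γ x)).symm y) := by
  rw [chartAt_quotient, OpenPartialHomeomorph.coe_trans_symm, Function.comp_apply,
    IsLocalHomeomorph.localInverseAt_symm]

omit [NormedSpace ℝ E] in
theorem chartAt_quotient_self (x : LeftQuotient Γ) :
    chartAt E x x = chartAt E (rep Γ x) (rep Γ x) := by
  have h := (isLocalHomeomorph_proj Γ).localInverseAt_apply_self (x := rep Γ x)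
  rw [proj_rep] at h
  rw [chartAt_quotient, OpenPartialHomeomorph.coe_trans, Function.comp_apply, h]

omit [TopologicalSpace G] [IsTopologicalGroup G] [T2Space G] [LocallyCompactSpace G]
  [DiscreteTopology Γ] in
theorem proj_rep_mul (a b : G) : proj Γ (rep Γ (proj Γ a) * a⁻¹ * b) = proj Γ b := by
  have h : MulAction.orbitRel Γ G (rep Γ (proj Γ a)) a := Quotient.exact (proj_rep Γ (proj Γ a))
  obtain ⟨γ, hγ⟩ := MulAction.mem_orbit_iff.1 (MulAction.orbitRel_apply.1 h)
  refine Quotient.sound (MulAction.orbitRel_apply.2 ⟨γ, ?_⟩)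
  rw [← hγ]
  simp [Subgroup.smul_def]

omit [NormedSpace ℝ E] in
/-- In the chart at `Γa`, the projection is near `a` the translation by the element of `Γ` that
moves `a` to the base point of this chart. -/
theorem chartAt_proj_eventuallyEq (a : G) : ∀ᶠ b in 𝓝 a, chartAt E (proj Γ a) (proj Γ b) =
    chartAt E (rep Γ (proj Γ a)) (rep Γ (proj Γ a) * a⁻¹ * b) := by
  set s := rep Γ (proj Γ a)
  let L := (isLocalHomeomorph_proj Γ).localInverseAt s
  have hL : ∀ᶠ b in 𝓝 a, s * a⁻¹ * b ∈ L.target := by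
    have : ContinuousAt (fun b => s * a⁻¹ * b) a := by fun_prop
    refine this.eventually_mem (L.open_target.mem_nhds ?_)
    rw [inv_mul_cancel_right]
    exact (isLocalHomeomorph_proj Γ).self_mem_localInverseAt_target
  filter_upwards [hL] with b hb
  have h := L.right_inv hb
  rw [(isLocalHomeomorph_proj Γ).localInverseAt_symm, proj_rep_mul] at h
  rw [chartAt_quotient, OpenPartialHomeomorph.coe_trans, Function.comp_apply]
  exact congrArg _ h

variable [LieGroup 𝓘(ℝ, E) ∞ G]

theorem mdifferentiableAt_proj (a : G) :
    MDifferentiableAt 𝓘(ℝ, E) 𝓘(ℝ, E) (proj Γ) a := by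
  refine mdifferentiableAt_of_chart rfl (isLocalHomeomorph_proj Γ).continuous.continuousAt ?_
  have hcont : Tendsto (chartAt E a).symm (𝓝 (chartAt E a a)) (𝓝 a) := by
    have := (chartAt E a).continuousAt_symm (mem_chart_target E a)
    rwa [ContinuousAt, (chartAt E a).left_inv (mem_chart_source E a)] at this
  have h1 : ContDiffAt ℝ ∞ (fun z => chartAt E (rep Γ (proj Γ a))
      (rep Γ (proj Γ a) * a⁻¹ * (chartAt E a).symm z)) (chartAt E a a) := by
    refine contDiffAt_chart (f := fun b => rep Γ (proj Γ a) * a⁻¹ * b) (mem_chart_target E a)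
      contMDiff_mul_left.contMDiffAt ?_
    rw [(chartAt E a).left_inv (mem_chart_source E a), inv_mul_cancel_right]
    exact mem_chart_source E _
  exact (h1.differentiableAt (by simp)).congr_of_eventuallyEq
    (hcont.eventually (chartAt_proj_eventuallyEq Γ a))

variable (E) in
/-- The frame of `Γ \ G` induced by the left-invariant fields. The chart of `Γ \ G` at `x` is the
chart of `G` at `rep Γ x`, so both have the same tangent space and no projection occurs. -/
def frame (x : LeftQuotient Γ) : E →L[ℝ] E := mderiv E (fun z => rep Γ x * z) 1

variable (E) in
/-- The coframe dual to `frame`. -/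
def coframe (x : LeftQuotient Γ) : E →L[ℝ] E := mderiv E (fun z => (rep Γ x)⁻¹ * z) (rep Γ x)

omit [IsTopologicalGroup G] [T2Space G] [LocallyCompactSpace G] [DiscreteTopology Γ] in
theorem coframe_frame (x : LeftQuotient Γ) (v : E) : coframe E Γ x (frame E Γ x v) = v :=
  DFunLike.congr_fun (mderiv_mul_left_inv_comp (E := E) (rep Γ x)) v

omit [IsTopologicalGroup G] [T2Space G] [LocallyCompactSpace G] [DiscreteTopology Γ] in
theorem frame_coframe (x : LeftQuotient Γ) (v : E) : frame E Γ x (coframe E Γ x v) = v :=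
  DFunLike.congr_fun (mderiv_mul_left_comp_inv (E := E) (rep Γ x)) v

/-- The frame does not depend on the representative: the projection carries the left-invariant frame
at every point of the fiber to the same frame. -/
theorem mderiv_proj_comp (a : G) :
    mderiv E (proj Γ) a ∘L mderiv E (fun z => a * z) 1 = frame E Γ (proj Γ a) := by
  have h1 := mdifferentiableAt_proj (E := E) Γ a
  have h2 := mdifferentiableAt_mul_left (E := E) a 1
  rw [← mderiv_comp h1 h2 (mul_one a), frame]
  have h3 : MDifferentiableAt 𝓘(ℝ, E) 𝓘(ℝ, E) (fun z => proj Γ (a * z)) 1 := by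
    rw [← mul_one a] at h1
    exact h1.comp 1 h2
  rw [mderiv_eq_fderiv h3 (congrArg (proj Γ) (mul_one a)),
    mderiv_eq_fderiv (mdifferentiableAt_mul_left _ _) (mul_one _)]
  refine EventuallyEq.fderiv_eq ?_
  have hcont : Tendsto (fun z => a * (chartAt E (1 : G)).symm z) (𝓝 (chartAt E (1 : G) 1))
      (𝓝 a) := by
    have : ContinuousAt (fun z => a * (chartAt E (1 : G)).symm z) (chartAt E (1 : G) 1) :=
      continuousAt_const.mul ((chartAt E (1 : G)).continuousAt_symm (mem_chart_target E 1))
    rwa [ContinuousAt, (chartAt E (1 : G)).left_inv (mem_chart_source E 1), mul_one] at this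
  filter_upwards [hcont.eventually (chartAt_proj_eventuallyEq (E := E) Γ a)] with z hz
  rw [hz, ← mul_assoc, inv_mul_cancel_right]

theorem inducedVector_eq (v : E) (a : G) :
    @inducedVector E _ _ G _ _ _ _ _ _ Γ _ v a = frame E Γ (proj Γ a) v :=
  DFunLike.congr_fun (mderiv_proj_comp (E := E) Γ a) v

theorem coframe_comp_mderiv_proj (b : G) :
    coframe E Γ (proj Γ b) ∘L mderiv E (proj Γ) b = mderiv E (fun z => b⁻¹ * z) b := by
  ext v
  have h1 := DFunLike.congr_fun (mderiv_mul_left_comp_inv (E := E) b) v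
  have h2 := DFunLike.congr_fun (mderiv_proj_comp (E := E) Γ b) (mderiv E (fun z => b⁻¹ * z) b v)
  simp only [ContinuousLinearMap.comp_apply, ContinuousLinearMap.id_apply] at h1 h2 ⊢
  rw [h1] at h2
  rw [h2, coframe_frame]

/-- The form on `Γ \ G` induced by the left-invariant form with value `α` at the identity. -/
def inducedForm (α : E [⋀^Fin p]→L[ℝ] ℝ) : Form E (LeftQuotient Γ) p := fun x =>
  α.compContinuousLinearMap (coframe E Γ x)

theorem inChart_inducedForm (α : E [⋀^Fin p]→L[ℝ] ℝ) (x : LeftQuotient Γ) {y : E}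
    (hy : y ∈ (chartAt E (rep Γ x)).target) :
    (inducedForm Γ α).inChart x y = (leftForm G α).inChart (rep Γ x) y := by
  have h1 : (chartAt E x).symm = fun y : E => proj Γ ((chartAt E (rep Γ x)).symm y) :=
    funext (chartAt_quotient_symm Γ x)
  rw [Form.inChart_eq, Form.inChart_eq, h1,
    mderiv_comp (mdifferentiableAt_proj Γ _) (mdifferentiableAt_chart_symm hy) rfl]
  change α.compContinuousLinearMap (coframe E Γ (proj Γ ((chartAt E (rep Γ x)).symm y)) ∘L
    mderiv E (proj Γ) ((chartAt E (rep Γ x)).symm y) ∘L _) = _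
  rw [← ContinuousLinearMap.comp_assoc, coframe_comp_mderiv_proj]
  rfl

theorem d_inducedForm (α : E [⋀^Fin p]→L[ℝ] ℝ) :
    (inducedForm Γ α).d =
      inducedForm Γ (frameDeriv (maurerCartan E G) (chartOne E G) α) := by
  funext x
  refine (Form.d_eq _ x).trans ?_
  have h : (inducedForm Γ α).inChart x =ᶠ[𝓝 (chartAt E x x)]
      (leftForm G α).inChart (rep Γ x) := by
    rw [chartAt_quotient_self]
    filter_upwards [(chartAt E (rep Γ x)).open_target.mem_nhds (mem_chart_target E _)] with y hy
    exact inChart_inducedForm Γ α x hy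
  rw [h.extDeriv_eq, chartAt_quotient_self, ← Form.d_eq, d_leftForm]
  rfl

omit [LieGroup 𝓘(ℝ, E) ∞ G] in
theorem wedge_inducedForm (a : E [⋀^Fin p]→L[ℝ] ℝ) (b : E [⋀^Fin q]→L[ℝ] ℝ)
    (x : LeftQuotient Γ) :
    (wedge (inducedForm Γ a x) (inducedForm Γ b x) : E [⋀^Fin (p + q)]→L[ℝ] ℝ) =
      inducedForm Γ (wedge a b) x :=
  (wedge_compContinuousLinearMap a b (coframe E Γ x)).symm

omit [LieGroup 𝓘(ℝ, E) ∞ G] in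
theorem wedgePow_inducedForm (w : E [⋀^Fin 2]→L[ℝ] ℝ) (k : ℕ) (x : LeftQuotient Γ) :
    (wedgePow (inducedForm Γ w x) k : E [⋀^Fin (2 * k)]→L[ℝ] ℝ) =
      inducedForm Γ (wedgePow w k) x :=
  (wedgePow_compContinuousLinearMap w (coframe E Γ x) k).symm

theorem inducedForm_apply_eq_zero_iff (a : E [⋀^Fin p]→L[ℝ] ℝ) (x : LeftQuotient Γ) :
    inducedForm Γ a x = 0 ↔ a = 0 := by
  refine ⟨fun h => ?_, fun h => by rw [h]; rfl⟩
  ext v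
  have := congrArg (fun f : E [⋀^Fin p]→L[ℝ] ℝ => f fun i => frame E Γ x (v i)) h
  refine Eq.trans ?_ this
  change a v = a fun i => coframe E Γ x (frame E Γ x (v i))
  simp only [coframe_frame]

end Quotient

/-! ### Gauduchon conditions for a constant form -/

section Algebra

variable {E : Type*} [NormedAddCommGroup E] [NormedSpace ℝ E] [FiniteDimensional ℝ E] {p q : ℕ}
  {θ : E → E →L[ℝ] E} {e : E}

/-- Forms of equal degree with the same image in the exterior algebra are equal, so any operation
takes the same value on them. -/
theorem toExt_congr {r : ℕ → ℕ} (f : ∀ {p : ℕ}, (E [⋀^Fin p]→L[ℝ] ℝ) → E [⋀^Fin (r p)]→L[ℝ] ℝ)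
    (hpq : p = q) {a : E [⋀^Fin p]→L[ℝ] ℝ} {b : E [⋀^Fin q]→L[ℝ] ℝ} (h : toExt a = toExt b) :
    toExt (f a) = toExt (f b) := by
  subst hpq
  rw [toExt_injective h]

omit [FiniteDimensional ℝ E] in
theorem frameDeriv_constOfIsEmpty (c : ℝ) :
    frameDeriv θ e (ContinuousAlternatingMap.constOfIsEmpty ℝ E (Fin 0) c) = 0 := by
  have h : (fun y => (ContinuousAlternatingMap.constOfIsEmpty ℝ E (Fin 0) c).compContinuousLinearMap
      (θ y)) = fun _ => ContinuousAlternatingMap.constOfIsEmpty ℝ E (Fin 0) c := rfl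
  rw [frameDeriv, h, extDeriv_constOfIsEmpty (fun _ : E => c) e]
  ext v
  simp

/-- `d(w^k) = k dw ∧ w^{k-1}`. -/
theorem toExt_frameDeriv_wedgePow (hθ : DifferentiableAt ℝ θ e) (he : θ e = .id ℝ E)
    (w : E [⋀^Fin 2]→L[ℝ] ℝ) (k : ℕ) :
    toExt (frameDeriv θ e (wedgePow w k)) =
      (k : ℝ) • (toExt (frameDeriv θ e w) * toExt w ^ (k - 1)) := by
  induction k with
  | zero =>
    have : frameDeriv θ e (wedgePow w 0) = 0 := frameDeriv_constOfIsEmpty 1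
    rw [this, toExt_zero, Nat.cast_zero, zero_smul]
  | succ k ih =>
    have hc := toExt_commute even_two w (frameDeriv θ e w)
    have h1 : toExt (frameDeriv θ e (wedgePow w (k + 1))) = _ :=
      toExt_frameDeriv_wedge hθ he (wedgePow w k) w
    rw [h1, ih, toExt_wedgePow, (even_two_mul k).neg_one_pow, one_smul, Nat.add_sub_cancel,
      (hc.pow_left k).eq, Nat.cast_add, Nat.cast_one, add_smul, one_smul, smul_mul_assoc, mul_assoc,
      ← pow_succ]
    rcases Nat.eq_zero_or_pos k with rfl | hk
    · simp
    · rw [Nat.sub_add_cancel hk]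

/-- The operator `d^c` on `w^k`, for a two-form `w` invariant under `J`. As `w^k` is of even degree
and invariant, the first action of `J` in `-J⁻¹ d J` is trivial. -/
def dcPow (θ : E → E →L[ℝ] E) (e : E) (J : E →L[ℝ] E) (w : E [⋀^Fin 2]→L[ℝ] ℝ) (k : ℕ) :
    E [⋀^Fin (2 * k + 1)]→L[ℝ] ℝ :=
  -(frameDeriv θ e (wedgePow w k)).compContinuousLinearMap J

/-- The form `d^c w`. -/
def dcForm (θ : E → E →L[ℝ] E) (e : E) (J : E →L[ℝ] E) (w : E [⋀^Fin 2]→L[ℝ] ℝ) :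
    E [⋀^Fin 3]→L[ℝ] ℝ :=
  -(frameDeriv θ e w).compContinuousLinearMap J

theorem toExt_neg (a : E [⋀^Fin p]→L[ℝ] ℝ) : toExt (-a) = -toExt a := by
  rw [← neg_one_smul ℝ a, toExt_smul, neg_one_smul]

/-- `d^c(w^k) = k d^c w ∧ w^{k-1}`. -/
theorem toExt_dcPow (hθ : DifferentiableAt ℝ θ e) (he : θ e = .id ℝ E) {J : E →L[ℝ] E}
    {w : E [⋀^Fin 2]→L[ℝ] ℝ} (hw : w.compContinuousLinearMap J = w) (k : ℕ) :
    toExt (dcPow θ e J w (k + 1)) =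
      toExt (((k + 1 : ℕ) : ℝ) • wedge (dcForm θ e J w) (wedgePow w k)) := by
  have h1 : toExt (frameDeriv θ e (wedgePow w (k + 1))) =
      toExt (((k + 1 : ℕ) : ℝ) • wedge (frameDeriv θ e w) (wedgePow w k)) := by
    rw [toExt_frameDeriv_wedgePow hθ he, toExt_smul, toExt_wedge, toExt_wedgePow,
      Nat.add_sub_cancel]
  have h2 : toExt ((frameDeriv θ e (wedgePow w (k + 1))).compContinuousLinearMap J) =
      toExt ((((k + 1 : ℕ) : ℝ) • wedge (frameDeriv θ e w)
        (wedgePow w k)).compContinuousLinearMap J) :=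
    toExt_congr (r := id) (fun {_} a => a.compContinuousLinearMap J) (by ring) h1
  have h3 : (((k + 1 : ℕ) : ℝ) • wedge (frameDeriv θ e w)
        (wedgePow w k)).compContinuousLinearMap J = ((k + 1 : ℕ) : ℝ) •
      wedge ((frameDeriv θ e w).compContinuousLinearMap J) (wedgePow w k) := by
    refine Eq.trans (congrArg (((k + 1 : ℕ) : ℝ) • ·) (wedge_compContinuousLinearMap _ _ J)) ?_
    rw [wedgePow_compContinuousLinearMap, hw]
  rw [dcPow, toExt_neg, h2, h3, toExt_smul, toExt_smul, toExt_wedge, toExt_wedge, dcForm, toExt_neg,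
    neg_mul, smul_neg]

/-- `d(d^c w ∧ w^k) = dd^c w ∧ w^k - k d^c w ∧ dw ∧ w^{k-1}`. -/
theorem toExt_frameDeriv_dcForm_wedge (hθ : DifferentiableAt ℝ θ e) (he : θ e = .id ℝ E)
    (J : E →L[ℝ] E) (w : E [⋀^Fin 2]→L[ℝ] ℝ) (k : ℕ) :
    toExt (frameDeriv θ e (wedge (dcForm θ e J w) (wedgePow w k))) =
      toExt (frameDeriv θ e (dcForm θ e J w)) * toExt w ^ k -
        (k : ℝ) • (toExt (dcForm θ e J w) * toExt (frameDeriv θ e w) * toExt w ^ (k - 1)) := by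
  rw [toExt_frameDeriv_wedge hθ he, toExt_wedgePow, toExt_frameDeriv_wedgePow hθ he, mul_smul_comm,
    mul_assoc, sub_eq_add_neg]
  congr 1
  simp [pow_succ]

/-- If the differential vanishes in codegree one, `dd^c w^k ∧ w^{n-k-1}` is a nonzero multiple of
`dd^c w ∧ w^{n-2}`. -/
theorem wedge_dcPow_eq_zero_iff (hθ : DifferentiableAt ℝ θ e) (he : θ e = .id ℝ E)
    {n : ℕ} (htop : ∀ a : E [⋀^Fin (3 + 2 * (n - 2))]→L[ℝ] ℝ, frameDeriv θ e a = 0)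
    {J : E →L[ℝ] E} {w : E [⋀^Fin 2]→L[ℝ] ℝ} (hw : w.compContinuousLinearMap J = w) {k : ℕ}
    (hk : 1 ≤ k) (hkn : k < n - 1) :
    wedge (frameDeriv θ e (dcPow θ e J w k)) (wedgePow w (n - k - 1)) = 0 ↔
      toExt (frameDeriv θ e (dcForm θ e J w)) * toExt w ^ (n - 2) = 0 := by
  obtain ⟨k, rfl⟩ : ∃ j, k = j + 1 := ⟨k - 1, by omega⟩
  obtain ⟨m, rfl⟩ : ∃ m, n = k + m + 3 := ⟨n - k - 3, by omega⟩
  rw [show k + m + 3 - 2 = k + m + 1 by omega] at htop ⊢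
  rw [show k + m + 3 - (k + 1) - 1 = m + 1 by omega]
  -- Both sides reduce to `Y = 0`, as the differential vanishes on `d^c w ∧ w^{n-2}`.
  set X := toExt (frameDeriv θ e (dcForm θ e J w)) * toExt w ^ (k + m + 1) with hX
  set Y := toExt (dcForm θ e J w) * toExt (frameDeriv θ e w) * toExt w ^ (k + m) with hY
  have hXY : X = ((k + m + 1 : ℕ) : ℝ) • Y := by
    have h := toExt_frameDeriv_dcForm_wedge hθ he J w (k + m + 1)
    rw [htop, toExt_zero, Nat.add_sub_cancel] at h
    exact sub_eq_zero.1 h.symm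
  have h1 : toExt (frameDeriv θ e (dcPow θ e J w (k + 1))) = toExt (frameDeriv θ e
      (((k + 1 : ℕ) : ℝ) • wedge (dcForm θ e J w) (wedgePow w k))) :=
    toExt_congr (fun {_} a => frameDeriv θ e a) (by ring) (toExt_dcPow hθ he hw k)
  have h2 : toExt (wedge (frameDeriv θ e (dcPow θ e J w (k + 1))) (wedgePow w (m + 1))) =
      ((k + 1 : ℕ) : ℝ) • (X - (k : ℝ) • Y) := by
    rw [toExt_wedge, h1, frameDeriv_smul, toExt_smul, toExt_frameDeriv_dcForm_wedge hθ he,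
      toExt_wedgePow, smul_mul_assoc, sub_mul, mul_assoc, ← pow_add, smul_mul_assoc, hX, hY,
      show k + m + 1 = k + (m + 1) by ring]
    rcases Nat.eq_zero_or_pos k with rfl | hk
    · simp
    · rw [mul_assoc _ (toExt w ^ (k - 1)), ← pow_add, show k - 1 + (m + 1) = k + m by omega]
  have h3 : X - (k : ℝ) • Y = ((m + 1 : ℕ) : ℝ) • Y := by
    rw [hXY, ← sub_smul]
    push_cast
    ring_nf
  have hne (j : ℕ) : ((j + 1 : ℕ) : ℝ) ≠ 0 := by exact_mod_cast j.succ_ne_zero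
  rw [← toExt_eq_zero_iff, h2, h3, hXY, smul_eq_zero_iff_right (hne k),
    smul_eq_zero_iff_right (hne m), smul_eq_zero_iff_right (hne (k + m))]

end Algebra

/-! ### Left-invariant Hermitian structures -/

section Hermitian

variable {E : Type*} [NormedAddCommGroup E] [NormedSpace ℝ E]
  {G : Type*} [Group G] [TopologicalSpace G] [IsTopologicalGroup G] [T2Space G]
  [LocallyCompactSpace G] [ChartedSpace E G] [LieGroup 𝓘(ℝ, E) ∞ G]
  {Γ : Subgroup G} [DiscreteTopology Γ] {p : ℕ}
  {J : AlmostComplexStructure E (LeftQuotient Γ)}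

/-- A left-invariant complex structure has constant coefficients in the frame of left-invariant
fields. -/
theorem exists_apply_frame_eq [FiniteDimensional ℝ E] (hJ : IsLeftInvariantComplexStructure J) :
    ∃ J₀ : E →L[ℝ] E, ∀ (x : LeftQuotient Γ) (v : E),
      J.toFun x (frame E Γ x v) = frame E Γ x (J₀ v) := by
  obtain ⟨J₀, -, h⟩ := hJ
  refine ⟨LinearMap.toContinuousLinearMap (E := E) (F' := E) J₀, fun x v => ?_⟩
  obtain ⟨a, rfl⟩ := proj_surjective Γ x
  have h1 := h a v
  erw [inducedVector_eq, inducedVector_eq] at h1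
  exact h1

/-- A left-invariant metric has constant coefficients in the frame of left-invariant fields. -/
theorem exists_apply_frame_frame_eq {g : HermitianMetric J} (hg : g.IsLeftInvariant) :
    ∃ g₀ : E → E → ℝ, ∀ (x : LeftQuotient Γ) (v w : E),
      g.toFun x (frame E Γ x v) (frame E Γ x w) = g₀ v w := by
  obtain ⟨g₀, h⟩ := hg
  refine ⟨fun v w => g₀ v w, fun x v w => ?_⟩
  obtain ⟨a, rfl⟩ := proj_surjective Γ x
  have h1 := h a v w
  erw [inducedVector_eq, inducedVector_eq] at h1
  exact h1

/-- The fundamental form of a left-invariant Hermitian structure is induced by a two-form on the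
Lie algebra, which is invariant under `J`. -/
theorem exists_fundamentalForm_eq {g : HermitianMetric J} (hg : g.IsLeftInvariant)
    {J₀ : E →L[ℝ] E} (hJ₀ : ∀ (x : LeftQuotient Γ) (v : E),
      J.toFun x (frame E Γ x v) = frame E Γ x (J₀ v)) :
    ∃ w : E [⋀^Fin 2]→L[ℝ] ℝ, w.compContinuousLinearMap J₀ = w ∧
      g.fundamentalForm = inducedForm Γ w := by
  obtain ⟨g₀, hg₀⟩ := exists_apply_frame_frame_eq hg
  let x₀ : LeftQuotient Γ := proj Γ 1
  let w : E [⋀^Fin 2]→L[ℝ] ℝ :=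
    ContinuousAlternatingMap.compContinuousLinearMap (g.fundamentalForm x₀) (frame E Γ x₀)
  have hw (v : Fin 2 → E) : w v = g₀ (J₀ (v 0)) (v 1) := by
    change g.toFun x₀ (J.toFun x₀ (frame E Γ x₀ (v 0))) (frame E Γ x₀ (v 1)) = _
    rw [hJ₀]
    exact hg₀ _ _ _
  refine ⟨w, ?_, ?_⟩
  · ext v
    change g.toFun x₀ (J.toFun x₀ (frame E Γ x₀ (J₀ (v 0)))) (frame E Γ x₀ (J₀ (v 1))) =
      g.toFun x₀ (J.toFun x₀ (frame E Γ x₀ (v 0))) (frame E Γ x₀ (v 1))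
    rw [← hJ₀ x₀ (v 0), ← hJ₀ x₀ (v 1)]
    exact g.compat x₀ _ _
  · funext x
    refine ContinuousAlternatingMap.ext fun v => ?_
    refine Eq.trans ?_ (hw fun i => coframe E Γ x (v i)).symm
    change g.toFun x (J.toFun x (v 0)) (v 1) = _
    rw [← hg₀ x]
    erw [← hJ₀ x, frame_coframe, frame_coframe]

theorem coframe_comp_apply {J₀ : E →L[ℝ] E} (hJ₀ : ∀ (x : LeftQuotient Γ) (v : E),
      J.toFun x (frame E Γ x v) = frame E Γ x (J₀ v)) (x : LeftQuotient Γ) (v : E) :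
    coframe E Γ x (J.toFun x v) = J₀ (coframe E Γ x v) := by
  have h := congrArg (coframe E Γ x) (hJ₀ x (coframe E Γ x v))
  rw [coframe_frame] at h
  erw [frame_coframe] at h
  exact h

/-- The action of `J` on induced forms is the action of `J₀` on forms on the Lie algebra. -/
theorem act_inducedForm {J₀ : E →L[ℝ] E} (hJ₀ : ∀ (x : LeftQuotient Γ) (v : E),
      J.toFun x (frame E Γ x v) = frame E Γ x (J₀ v)) (a : E [⋀^Fin p]→L[ℝ] ℝ) :
    J.act (inducedForm Γ a) = inducedForm Γ ((-1 : ℝ) ^ p • a.compContinuousLinearMap J₀) := by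
  funext x
  refine ContinuousAlternatingMap.ext fun v => ?_
  change (-1 : ℝ) ^ p * a (fun i => coframe E Γ x (J.toFun x (v i))) =
    (-1 : ℝ) ^ p * a (fun i => J₀ (coframe E Γ x (v i)))
  exact congrArg (fun u => (-1 : ℝ) ^ p * a u) (funext fun i => coframe_comp_apply hJ₀ x (v i))

/-- The operator `d^c` on the powers of an invariant two-form. -/
theorem dc_inducedForm_wedgePow {J₀ : E →L[ℝ] E} (hJ₀ : ∀ (x : LeftQuotient Γ) (v : E),
      J.toFun x (frame E Γ x v) = frame E Γ x (J₀ v)) {w : E [⋀^Fin 2]→L[ℝ] ℝ}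
    (hw : w.compContinuousLinearMap J₀ = w) (k : ℕ) :
    J.dc (inducedForm Γ (wedgePow w k)) =
      inducedForm Γ (dcPow (maurerCartan E G) (chartOne E G) J₀ w k) := by
  have h1 : J.act (inducedForm Γ (wedgePow w k)) = inducedForm Γ (wedgePow w k) := by
    rw [act_inducedForm hJ₀, wedgePow_compContinuousLinearMap, hw, (even_two_mul k).neg_one_pow,
      one_smul]
  funext x
  rw [AlmostComplexStructure.dc, h1, d_inducedForm, AlmostComplexStructure.actInv,
    act_inducedForm hJ₀]
  refine ContinuousAlternatingMap.ext fun v => ?_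
  change -((-1 : ℝ) ^ (2 * k + 1) * ((-1 : ℝ) ^ (2 * k + 1) * _)) = -_
  -- The two signs, of `J` and of `J⁻¹` on forms of degree `2k + 1`, cancel.
  rw [← mul_assoc, ← mul_pow, neg_one_mul, neg_neg, one_pow, one_mul]

/-- The Gauduchon condition is a condition on forms on the Lie algebra. -/
theorem isGauduchon_iff {g : HermitianMetric J} {J₀ : E →L[ℝ] E}
    (hJ₀ : ∀ (x : LeftQuotient Γ) (v : E), J.toFun x (frame E Γ x v) = frame E Γ x (J₀ v))
    {w : E [⋀^Fin 2]→L[ℝ] ℝ} (hw : w.compContinuousLinearMap J₀ = w)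
    (hgw : g.fundamentalForm = inducedForm Γ w) (n k : ℕ) :
    g.IsGauduchon n k ↔ wedge (frameDeriv (maurerCartan E G) (chartOne E G)
      (dcPow (maurerCartan E G) (chartOne E G) J₀ w k)) (wedgePow w (n - k - 1)) = 0 := by
  have hpow (j : ℕ) : (fun y => wedgePow (inducedForm Γ w y) j) = inducedForm Γ (wedgePow w j) :=
    funext (wedgePow_inducedForm Γ w j)
  have key (x : LeftQuotient Γ) :
      wedge ((J.dc fun y => wedgePow (g.fundamentalForm y) k).d x)
        (wedgePow (g.fundamentalForm x) (n - k - 1)) =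
      inducedForm Γ (wedge (frameDeriv (maurerCartan E G) (chartOne E G)
        (dcPow (maurerCartan E G) (chartOne E G) J₀ w k)) (wedgePow w (n - k - 1))) x := by
    rw [hgw, hpow, dc_inducedForm_wedgePow hJ₀ hw, d_inducedForm]
    exact (congrArg (wedge (V := E) _) (wedgePow_inducedForm Γ w _ x)).trans
      (wedge_inducedForm (E := E) Γ _ _ x)
  refine ⟨fun h => ?_, fun h x => ?_⟩
  · exact (inducedForm_apply_eq_zero_iff Γ _ (proj Γ 1)).1 ((key _).symm.trans (h _))
  · exact (key x).trans ((inducedForm_apply_eq_zero_iff Γ _ x).2 h)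

end Hermitian

end

end Nilmanifold

theorem lemma4p6
    {E : Type*} [NormedAddCommGroup E] [NormedSpace ℝ E] [FiniteDimensional ℝ E]
    {G : Type*} [Group G] [TopologicalSpace G] [IsTopologicalGroup G] [T2Space G]
    [LocallyCompactSpace G] [ChartedSpace E G] [LieGroup 𝓘(ℝ, E) ∞ G]
    [SimplyConnectedSpace G] [Group.IsNilpotent G]
    (Γ : Subgroup G) [DiscreteTopology Γ] [CompactSpace (Nilmanifold.LeftQuotient Γ)]
    (n : ℕ) (hn : Module.finrank ℝ E = 2 * n)
    (J : Nilmanifold.AlmostComplexStructure E (Nilmanifold.LeftQuotient Γ))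
    (hJ : Nilmanifold.IsLeftInvariantComplexStructure J)
    (g : Nilmanifold.HermitianMetric J) (hg : g.IsLeftInvariant)
    (k : ℕ) (hk : 1 ≤ k) (hkn : k < n - 1) :
    g.IsGauduchon n k ↔ g.IsGauduchon n 1 := by
  obtain ⟨J₀, hJ₀⟩ := Nilmanifold.exists_apply_frame_eq hJ
  obtain ⟨w, hw, hgw⟩ := Nilmanifold.exists_fundamentalForm_eq hg hJ₀
  rw [Nilmanifold.isGauduchon_iff hJ₀ hw hgw, Nilmanifold.isGauduchon_iff hJ₀ hw hgw]
  have h {j : ℕ} (hj : 1 ≤ j) (hjn : j < n - 1) := Nilmanifold.wedge_dcPow_eq_zero_iff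
    (Nilmanifold.differentiableAt_maurerCartan (E := E) (G := G)) Nilmanifold.maurerCartan_one
    (Nilmanifold.frameDeriv_maurerCartan_eq_zero (by omega)) hw hj hjn
  exact (h hk hkn).trans (h le_rfl (hk.trans_lt hkn)).symm
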